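/- **Setting.** Let $y_1,y_2,\dots$ be observed data. A *Polish metric space* is a complete separable metric space with its Borel $\sigma$-algebra. Let $\bar X$ be the space of the unknown, with a metric $d_{\bar X}$ making it a Polish metric space. Each problem below gives, for each step $k\ge 1$, a map $\tilde F_k$ from probability measures on $\bar X$ to measures on $\bar X$. The evidence is $Z_k(\mu)=\tilde F_k\mu(\bar X)$ and the prior-to-posterior map is $F_k\mu=\tilde F_k\mu/Z_k(\mu)$. All models $h,T$ are real-valued, nonnegative and measurable; $dx$, $dw$ denote fixed $\sigma$-finite reference measures on $X$, $W$ (e.g. Lebesgue measure). * *Inverse problem (IP)*, $\bar X=X$: likelihood $h(y,x)$; $\tilde F_k\mu(dx)=h(y_k,x)\mu(dx)$. A probability measure $\mu$ is admissible at step $k$ if $0<Z_k(\mu)<\infty$. Set $C_h(y)=\sup_x h(y,x)$ and let $\|h\|_{\rm Lip}(y)$ be the best Lipschitz constant of $h(y,\cdot)$. The joint density of the data is $p(y_{1:n})=\int\prod_{i=1}^n h(y_i,x)\,P_0(dx)$. * *State estimation (SE)*, $\bar X=X$: transition densities $T_k(x,x')$ (from $x'$ to $x$) and observation densities $h_k(y,x)$;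 $\tilde F_k\mu(dx)=h_k(y_k,x)\big(\int T_k(x,x')\mu(dx')\big)dx$. Admissible: $\int T_k(x,x')\mu(dx')<\infty$ for all $x$, and $0<Z_k(\mu)<\infty$. Set $C_{Th}(y_k;k)=\sup_{x'}\int h_k(y_k,x)T_k(x,x')dx$; let $T_{\rm Lip}(x;k)$ be the best Lipschitz constant of $T_k(x,\cdot)$ and $C^*_{Th}(y_k;k)=\int h_k(y_k,x)T_{\rm Lip}(x;k)dx$. Here $p(y_{1:n})=\int P_0(dx_0)\int\prod_{i=1}^n h_i(y_i,x_i)T_i(x_i,x_{i-1})\,dx_1\cdots dx_n$. * *Parameter-state estimation (PS)*, $\bar X=X\times W$: $T_k(x,x',w)$ and $h_k(y,x,w)$; for $\mu$ with density $\pi$ with respect to $dx\,dw$, $\tilde F_k\mu(dx,dw)=h_k(y_k,x,w)\big(\int T_k(x,x',w)\pi(x',w)dx'\big)dx\,dw$. Admissible: $\mu$ has such a density, $\int T_k(x,x',w)\pi(x',w)dx'<\infty$ for all $x,w$ (for some version of $\pi$), and $0<Z_k(\mu)<\infty$. Set $\tilde C_{Th}(y_k;k)=\sup_{x',w}\int h_k(y_k,x,w)T_k(x,x',w)dx$;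 let $\tilde f_{\rm Lip}(x;k)$ be the best Lipschitz constant of $(x',w)\mapsto h_k(y_k,x,w)T_k(x,x',w)$ and $\tilde C^*_{Th}(y_k;k)=\int\tilde f_{\rm Lip}(x;k)dx$. Here $p(y_{1:n})=\int P_0(dx_0,dw)\int\prod_{i=1}^n h_i(y_i,x_i,w)T_i(x_i,x_{i-1},w)\,dx_1\cdots dx_n$. In each case $p(y_{j+1:k}\mid y_{1:j})=p(y_{1:k})/p(y_{1:j})$. The true posteriors are $P_k=F_k(P_{k-1})$, from an initial probability measure $P_0$. The approximate posteriors are arbitrary probability measures $Q_1,Q_2,\dots$, with $Q_0=P_0$; put $Q_j^*=F_j(Q_{j-1})$. Let $d_{TV}(\mu,\mu')=\sup_A|\mu(A)-\mu'(A)|$, $d_H(\mu,\mu')=\big(\tfrac12\int(\sqrt{d\mu/d\nu}-\sqrt{d\mu'/d\nu})^2d\nu\big)^{1/2}$ (any dominating $\nu$), and $W_1(\mu,\mu')=\inf_\gamma\int d_{\bar X}\,d\gamma$ over couplings $\gamma$ of $\mu,\mu'$. **Theorem.** Let $k\ge2$. Assume $P_i$ is admissible at step $i+1$ for $0\le i\le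 k-1$, and $Q_i$ is admissible at step $i+1$ for $1\le i\le k-1$. Assume further, for every step $i\in\{1,\dots,k\}$: * for $d=d_{TV}$ or $d=d_H$: $C_h(y_i)<\infty$ (IP); $C_{Th}(y_i;i)<\infty$ (SE); $\tilde C_{Th}(y_i;i)<\infty$ (PS); * for $d=W_1$: $D:=\sup_{\bar x,\bar x'}d_{\bar X}(\bar x,\bar x')<\infty$, and in addition $C_h(y_i)<\infty$ and $\|h\|_{\rm Lip}(y_i)<\infty$ (IP); $T_{\rm Lip}(x;i)<\infty$ for all $x$ and $C^*_{Th}(y_i;i)<\infty$ (SE); $\tilde C_{Th}(y_i;i)<\infty$, $\tilde f_{\rm Lip}(x;i)<\infty$ for all $x$, $\tilde C^*_{Th}(y_i;i)<\infty$, and $d_{\bar X}((x,w),(x,w'))\le d_{\bar X}((\tilde x,w),(x',w'))$ for all $x,\tilde x,x'\in X$ and $w,w'\in W$ (PS). Then $$d(P_k,Q_k)\le\sum_{j=1}^{k-1}C_j\,d(Q_j^*,Q_j)+d(Q_k^*,Q_k)\qquad\text{and}\qquad d(P_k,Q_k)\le\sum_{j=1}^{k-1}C'_j\,d(Q_j^*,Q_j)+d(Q_k^*,Q_k).$$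 For $d=d_{TV}$, with $c_i=C_h(y_i)$, $C_{Th}(y_i;i)$, $\tilde C_{Th}(y_i;i)$ in IP, SE, PS respectively, $$C_j=\frac{\prod_{i=j+1}^kc_i}{p(y_{j+1:k}\mid y_{1:j})},\qquad C_j'=\prod_{i=j+1}^k\frac{c_i}{Z_i(Q_{i-1})};$$ for $d=d_H$, with the same $c_i$, $$C_j=\frac{2^{k-j}\prod_{i=j+1}^k\sqrt{c_i}}{\sqrt{p(y_{j+1:k}\mid y_{1:j})}},\qquad C_j'=2^{k-j}\prod_{i=j+1}^k\frac{\sqrt{c_i}}{\sqrt{Z_i(Q_{i-1})}};$$ for $d=W_1$, $C_j$ and $C_j'$ are given by the formulas for $d_{TV}$ with $c_i=2D\|h\|_{\rm Lip}(y_i)+C_h(y_i)$ (IP), $c_i=2D\,C^*_{Th}(y_i;i)$ (SE), $c_i=2D\,\tilde C^*_{Th}(y_i;i)+\tilde C_{Th}(y_i;i)$ (PS). -/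

import Mathlib

open MeasureTheory
open scoped NNReal ENNReal

noncomputable section

namespace BayesSeq

/-! ### Metrics and distances between probability measures -/

/-- `d` is a metric on `Z` for which `Z` is complete and separable and whose Borel `σ`-algebra is
the given one. The metric is passed as a function, since a metric on a product `X × W` is arbitrary
here and need not be the one Mathlib puts on products. -/
def IsPolishMetric {Z : Type*} [MeasurableSpace Z] (d : Z → Z → ℝ) : Prop :=
  ∃ _ : MetricSpace Z, (∀ x y : Z, dist x y = d x y) ∧
    CompleteSpace Z ∧ TopologicalSpace.SeparableSpace Z ∧ BorelSpace Z

/-- The best Lipschitz constant of `f` with respect to `d`: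
the supremum of `|f x - f x'| / d x x'` over `x ≠ x'` (it is `∞` if `f` is not Lipschitz). -/
def lipConst {Z : Type*} (d : Z → Z → ℝ) (f : Z → ℝ) : ℝ≥0∞ :=
  ⨆ (x : Z) (x' : Z) (_ : x ≠ x'), ENNReal.ofReal (|f x - f x'| / d x x')

/-- Total variation distance, `sup_A |μ A - μ' A|` over measurable `A`. -/
def tvDist {Z : Type*} [MeasurableSpace Z] (μ μ' : Measure Z) : ℝ :=
  ⨆ A : {A : Set Z // MeasurableSet A}, |μ.real A - μ'.real A|

/-- Hellinger distance, computed with the dominating measure `μ + μ'`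
(its value does not depend on the dominating measure). -/
def hellingerDist {Z : Type*} [MeasurableSpace Z] (μ μ' : Measure Z) : ℝ :=
  √((1 / 2) * ∫ z, (√(μ.rnDeriv (μ + μ') z).toReal - √(μ'.rnDeriv (μ + μ') z).toReal) ^ 2
    ∂(μ + μ'))

/-- The set of couplings of `μ` and `μ'`. -/
def couplings {Z : Type*} [MeasurableSpace Z] (μ μ' : Measure Z) : Set (Measure (Z × Z)) :=
  {γ | γ.map Prod.fst = μ ∧ γ.map Prod.snd = μ'}

/-- The `1`-Wasserstein distance for the metric `d`. -/
def wasserstein1 {Z : Type*} [MeasurableSpace Z] (d : Z → Z → ℝ) (μ μ' : Measure Z) : ℝ :=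
  (⨅ γ ∈ couplings μ μ', ∫⁻ p, ENNReal.ofReal (d p.1 p.2) ∂γ).toReal

/-! ### Prior-to-posterior maps

An update is described by its unnormalized map `Ft`; the evidence is the total mass, and the
posterior is the normalized measure. -/

/-- The evidence `Z(μ)`, as an extended nonnegative number. -/
def evidence {Z : Type*} [MeasurableSpace Z] (Ft : Measure Z → Measure Z) (μ : Measure Z) : ℝ≥0∞ :=
  Ft μ Set.univ

/-- The prior-to-posterior map `F(μ) = Ft(μ) / Z(μ)`. -/
def posterior {Z : Type*} [MeasurableSpace Z] (Ft : Measure Z → Measure Z) (μ : Measure Z) :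
    Measure Z :=
  (evidence Ft μ)⁻¹ • Ft μ

/-- The true posteriors: `P_0` is the initial prior and `P_{k+1} = F_{k+1}(P_k)`. -/
def truePosterior {Z : Type*} [MeasurableSpace Z] (Ft : ℕ → Measure Z → Measure Z)
    (P0 : Measure Z) : ℕ → Measure Z
  | 0 => P0
  | k + 1 => posterior (Ft (k + 1)) (truePosterior Ft P0 k)

/-- `Q*_j = F_j(Q_{j-1})`, for `j ≥ 1`. -/
def exactUpdate {Z : Type*} [MeasurableSpace Z] (Ft : ℕ → Measure Z → Measure Z)
    (Q : ℕ → Measure Z) (j : ℕ) : Measure Z :=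
  posterior (Ft j) (Q (j - 1))

/-- The right-hand side `∑_{j=1}^{k-1} c_j d(Q*_j, Q_j) + d(Q*_k, Q_k)`. -/
def errorBound {Z : Type*} [MeasurableSpace Z] (d : Measure Z → Measure Z → ℝ) (c : ℕ → ℝ)
    (Ft : ℕ → Measure Z → Measure Z) (Q : ℕ → Measure Z) (k : ℕ) : ℝ :=
  ∑ j ∈ Finset.Icc 1 (k - 1), c j * d (exactUpdate Ft Q j) (Q j) + d (exactUpdate Ft Q k) (Q k)

/-- The conditional density `p(y_{j+1:k} | y_{1:j}) = p(y_{1:k}) / p(y_{1:j})`, where `p n` is the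
joint density of the first `n` data points at the observed values. -/
def predictive (p : ℕ → ℝ≥0∞) (j k : ℕ) : ℝ :=
  (p k / p j).toReal

/-! ### Inverse problems -/

/-- An inverse problem: the likelihood `h y x = p(y | x)`. -/
structure IPModel (X Y : Type*) [MeasurableSpace X] where
  h : Y → X → ℝ≥0
  measurable_h : ∀ y, Measurable (h y)

namespace IPModel

variable {X Y : Type*} [MeasurableSpace X]

/-- `h(y_k, x) μ(dx)`. -/
def update (M : IPModel X Y) (y : ℕ → Y) (k : ℕ) (μ : Measure X) : Measure X :=
  μ.withDensity fun x => (M.h (y k) x : ℝ≥0∞)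

/-- Admissible priors at step `k`. -/
def Admissible (M : IPModel X Y) (y : ℕ → Y) (k : ℕ) (μ : Measure X) : Prop :=
  IsProbabilityMeasure μ ∧
    0 < ∫⁻ x, (M.h (y k) x : ℝ≥0∞) ∂μ ∧ ∫⁻ x, (M.h (y k) x : ℝ≥0∞) ∂μ < ∞

/-- The joint density `p(y_{1:n})`; the data are conditionally independent given `X ∼ P0`. -/
def jointDensity (M : IPModel X Y) (P0 : Measure X) (y : ℕ → Y) (n : ℕ) : ℝ≥0∞ :=
  ∫⁻ x, ∏ i ∈ Finset.Icc 1 n, (M.h (y i) x : ℝ≥0∞) ∂P0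

/-- `C_h(y_k) = sup_x h(y_k, x)`. -/
def C (M : IPModel X Y) (y : ℕ → Y) (k : ℕ) : ℝ≥0∞ :=
  ⨆ x, (M.h (y k) x : ℝ≥0∞)

/-- The best Lipschitz constant of `h(y_k, ·)`. -/
def hLip (M : IPModel X Y) (d : X → X → ℝ) (y : ℕ → Y) (k : ℕ) : ℝ≥0∞ :=
  lipConst d fun x => (M.h (y k) x : ℝ)

end IPModel

/-! ### State estimation -/

/-- A hidden Markov model: `T k x x' = p(x_k = x | x_{k-1} = x')` is the transition density with
respect to a reference measure on `X`, and `h k y x = p(y_k = y | x_k = x)`. -/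
structure SEModel (X Y : Type*) [MeasurableSpace X] where
  T : ℕ → X → X → ℝ≥0
  h : ℕ → Y → X → ℝ≥0
  measurable_T : ∀ k, Measurable fun p : X × X => T k p.1 p.2
  measurable_h : ∀ k y, Measurable (h k y)

namespace SEModel

variable {X Y : Type*} [MeasurableSpace X]

/-- `h_k(y_k, x) (∫ T_k(x, x') μ(dx')) dx`, where `dx` stands for the reference measure `ν`. -/
def update (M : SEModel X Y) (ν : Measure X) (y : ℕ → Y) (k : ℕ) (μ : Measure X) : Measure X :=
  ν.withDensity fun x => (M.h k (y k) x : ℝ≥0∞) * ∫⁻ x', (M.T k x x' : ℝ≥0∞) ∂μ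

/-- Admissible priors at step `k`. -/
def Admissible (M : SEModel X Y) (ν : Measure X) (y : ℕ → Y) (k : ℕ) (μ : Measure X) : Prop :=
  IsProbabilityMeasure μ ∧
    (∀ x, ∫⁻ x', (M.T k x x' : ℝ≥0∞) ∂μ < ∞) ∧
    0 < ∫⁻ x, (M.h k (y k) x : ℝ≥0∞) * ∫⁻ x', (M.T k x x' : ℝ≥0∞) ∂μ ∂ν ∧
    ∫⁻ x, (M.h k (y k) x : ℝ≥0∞) * ∫⁻ x', (M.T k x x' : ℝ≥0∞) ∂μ ∂ν < ∞

/-- The joint density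
`p(y_{1:n}) = ∫ P0(dx_0) ∫_{X^n} ∏_{i=1}^n h_i(y_i, x_i) T_i(x_i, x_{i-1}) dx_1 ⋯ dx_n`.
The path `(x_1, …, x_n)` is `x : Fin n → X`, so that `x i` is the state at time `i + 1` and entry
`i` of `Fin.cons x0 x` is the state at time `i`. -/
def jointDensity (M : SEModel X Y) (ν : Measure X) (P0 : Measure X) (y : ℕ → Y) (n : ℕ) : ℝ≥0∞ :=
  ∫⁻ x0, ∫⁻ x : Fin n → X,
      ∏ i : Fin n, (M.h ((i : ℕ) + 1) (y ((i : ℕ) + 1)) (x i) : ℝ≥0∞) *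
        (M.T ((i : ℕ) + 1) (x i) (Fin.cons (α := fun _ => X) x0 x i.castSucc) : ℝ≥0∞)
    ∂(Measure.pi fun _ => ν) ∂P0

/-- `C_{Th}(y_k; k) = sup_{x'} ∫ h_k(y_k, x) T_k(x, x') dx`. -/
def C (M : SEModel X Y) (ν : Measure X) (y : ℕ → Y) (k : ℕ) : ℝ≥0∞ :=
  ⨆ x', ∫⁻ x, (M.h k (y k) x : ℝ≥0∞) * (M.T k x x' : ℝ≥0∞) ∂ν

/-- `T_Lip(x; k)`, the best Lipschitz constant of `T_k(x, ·)`. -/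
def TLip (M : SEModel X Y) (d : X → X → ℝ) (k : ℕ) (x : X) : ℝ≥0∞ :=
  lipConst d fun x' => (M.T k x x' : ℝ)

/-- `C*_{Th}(y_k; k) = ∫ h_k(y_k, x) T_Lip(x; k) dx`. -/
def Cstar (M : SEModel X Y) (ν : Measure X) (d : X → X → ℝ) (y : ℕ → Y) (k : ℕ) : ℝ≥0∞ :=
  ∫⁻ x, (M.h k (y k) x : ℝ≥0∞) * M.TLip d k x ∂ν

end SEModel

/-! ### Parameter-state estimation -/

/-- A hidden Markov model with unknown parameter `w`:
`T k x x' w = p(x_k = x | x_{k-1} = x', w)` and `h k y x w = p(y_k = y | x_k = x, w)`. -/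
structure PSModel (X W Y : Type*) [MeasurableSpace X] [MeasurableSpace W] where
  T : ℕ → X → X → W → ℝ≥0
  h : ℕ → Y → X → W → ℝ≥0
  measurable_T : ∀ k, Measurable fun p : X × X × W => T k p.1 p.2.1 p.2.2
  measurable_h : ∀ k y, Measurable fun p : X × W => h k y p.1 p.2

namespace PSModel

variable {X W Y : Type*} [MeasurableSpace X] [MeasurableSpace W]

/-- The density `h_k(y_k, x, w) ∫ T_k(x, x', w) π(x', w) dx'` at `(x, w)`, for a prior density `π`
with respect to `ν ⊗ ρ`, where `ν` and `ρ` are the reference measures on `X` and `W`. -/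
def updateDensity (M : PSModel X W Y) (ν : Measure X) (y : ℕ → Y) (k : ℕ) (π : X × W → ℝ≥0∞)
    (p : X × W) : ℝ≥0∞ :=
  (M.h k (y k) p.1 p.2 : ℝ≥0∞) * ∫⁻ x', (M.T k p.1 x' p.2 : ℝ≥0∞) * π (x', p.2) ∂ν

/-- The unnormalized posterior; `π` is the density of `μ` with respect to `ν ⊗ ρ`. -/
def update (M : PSModel X W Y) (ν : Measure X) (ρ : Measure W) (y : ℕ → Y) (k : ℕ)
    (μ : Measure (X × W)) : Measure (X × W) :=
  (ν.prod ρ).withDensity (M.updateDensity ν y k (μ.rnDeriv (ν.prod ρ)))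

/-- Admissible priors at step `k`: `μ` has a density `π` with respect to `ν ⊗ ρ`, some version of
which satisfies the two conditions for the posterior to be well-defined. -/
def Admissible (M : PSModel X W Y) (ν : Measure X) (ρ : Measure W) (y : ℕ → Y) (k : ℕ)
    (μ : Measure (X × W)) : Prop :=
  IsProbabilityMeasure μ ∧
    ∃ π : X × W → ℝ≥0∞, Measurable π ∧ μ = (ν.prod ρ).withDensity π ∧
      (∀ x w, ∫⁻ x', (M.T k x x' w : ℝ≥0∞) * π (x', w) ∂ν < ∞) ∧
      0 < ∫⁻ p, M.updateDensity ν y k π p ∂(ν.prod ρ) ∧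
      ∫⁻ p, M.updateDensity ν y k π p ∂(ν.prod ρ) < ∞

/-- The joint density `p(y_{1:n}) =
∫ P0(dx_0, dw) ∫_{X^n} ∏_{i=1}^n h_i(y_i, x_i, w) T_i(x_i, x_{i-1}, w) dx_1 ⋯ dx_n`
(indexing of paths as in `SEModel.jointDensity`). -/
def jointDensity (M : PSModel X W Y) (ν : Measure X) (P0 : Measure (X × W)) (y : ℕ → Y) (n : ℕ) :
    ℝ≥0∞ :=
  ∫⁻ q, ∫⁻ x : Fin n → X,
      ∏ i : Fin n, (M.h ((i : ℕ) + 1) (y ((i : ℕ) + 1)) (x i) q.2 : ℝ≥0∞) *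
        (M.T ((i : ℕ) + 1) (x i) (Fin.cons (α := fun _ => X) q.1 x i.castSucc) q.2 : ℝ≥0∞)
    ∂(Measure.pi fun _ => ν) ∂P0

/-- `sup_{x', w} ∫ h_k(y_k, x, w) T_k(x, x', w) dx`. -/
def C (M : PSModel X W Y) (ν : Measure X) (y : ℕ → Y) (k : ℕ) : ℝ≥0∞ :=
  ⨆ (x' : X) (w : W), ∫⁻ x, (M.h k (y k) x w : ℝ≥0∞) * (M.T k x x' w : ℝ≥0∞) ∂ν

/-- The best Lipschitz constant of `(x', w) ↦ h_k(y_k, x, w) T_k(x, x', w)`. -/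
def fLip (M : PSModel X W Y) (d : X × W → X × W → ℝ) (y : ℕ → Y) (k : ℕ) (x : X) : ℝ≥0∞ :=
  lipConst d fun q : X × W => (M.h k (y k) x q.2 : ℝ) * (M.T k x q.1 q.2 : ℝ)

/-- The integral of `fLip` over `x`. -/
def Cstar (M : PSModel X W Y) (ν : Measure X) (d : X × W → X × W → ℝ) (y : ℕ → Y) (k : ℕ) :
    ℝ≥0∞ :=
  ∫⁻ x, M.fLip d y k x ∂ν

end PSModel

end BayesSeq

end

open BayesSeq

namespace BayesSeq

/-! The three problems share one form. From a state `u` the update spreads mass `k (e, u) m(de)`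
over the points `φ (e, u)`. For IP, `e` ranges over a one-point space and `φ` keeps `u`; for SE, `e`
is the new state and `φ` returns it; for PS, `e` replaces the state and the parameter is kept. It
suffices to show, for each distance, that one normalized update expands it by a factor at most `c /
Z`, with `Z` the evidence of either prior (for Hellinger, `2 √c / √Z`). The triangle inequality
through `Q*_i` and induction (`dist_truePosterior_le`) then give products of these factors. With the
evidences of the approximate posteriors this is the second bound. With those of the true posteriors
it is the first, because the joint density is the product of the true evidences
(`lintegral_eq_prod_evidence`).

Total variation (`tvDist_normalize_pushUpdate_le`): the difference of the posterior probabilities of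
`A`, times `Z`, is the integral against `μ - μ'` of a function whose range has length at most `C`.

Hellinger: write measures through square roots of densities, so that the distance is an `L²` norm.
The unnormalized update increases its square by a factor at most `C`, because affinity satisfies a
data-processing inequality (`hellingerDist_pushUpdate_le`). Normalizing costs the factor `2 / √Z`
(`hellingerDist_normalize_le`).

Wasserstein (`transportCost_normalize_pushUpdate_le`): given a coupling of the priors, use the same
`e` for both points and move the common mass `min (k (e, u)) (k (e, v))` from `φ (e, u)` to `φ (e,
v)`. The Lipschitz bound on the kernel controls the unmatched mass, which travels at most the
diameter `D`. -/

/-- The update `μ ↦ ∫ μ(du) ∫ m(de) k(e, u) δ_{φ(e, u)}`, of which the prior-to-posterior maps of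
all three problems are instances. -/
noncomputable def pushUpdate {E Z : Type*} [MeasurableSpace E] [MeasurableSpace Z] (m : Measure E)
    (k : E × Z → ℝ≥0∞) (φ : E × Z → Z) (μ : Measure Z) : Measure Z :=
  ((m.prod μ).withDensity k).map φ

/-! ### Push updates: integration formulas -/

section PushUpdate

variable {E Z : Type*} [MeasurableSpace E] [MeasurableSpace Z] {m : Measure E}
  {k : E × Z → ℝ≥0∞} {φ : E × Z → Z}

theorem lintegral_pushUpdate [SFinite m] (hk : Measurable k) (hφ : Measurable φ) (μ : Measure Z)
    [SFinite μ] {g : Z → ℝ≥0∞} (hg : Measurable g) :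
    ∫⁻ z, g z ∂(pushUpdate m k φ μ) = ∫⁻ u, ∫⁻ e, k (e, u) * g (φ (e, u)) ∂m ∂μ := by
  rw [pushUpdate, lintegral_map hg hφ]
  change ∫⁻ a, (g ∘ φ) a ∂_ = _
  rw [lintegral_withDensity_eq_lintegral_mul _ hk (hg.comp hφ)]
  exact lintegral_prod_symm' _ (hk.mul (hg.comp hφ))

theorem pushUpdate_apply [SFinite m] (hk : Measurable k) (hφ : Measurable φ) (μ : Measure Z)
    [SFinite μ] {A : Set Z} (hA : MeasurableSet A) :
    pushUpdate m k φ μ A = ∫⁻ u, ∫⁻ e, k (e, u) * A.indicator 1 (φ (e, u)) ∂m ∂μ := by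
  rw [← lintegral_pushUpdate hk hφ μ (measurable_one.indicator hA), lintegral_indicator_one hA]

theorem pushUpdate_univ [SFinite m] (hk : Measurable k) (hφ : Measurable φ) (μ : Measure Z)
    [SFinite μ] : pushUpdate m k φ μ Set.univ = ∫⁻ u, ∫⁻ e, k (e, u) ∂m ∂μ := by
  simp [pushUpdate_apply hk hφ μ MeasurableSet.univ]

/-- A measure is a push update as soon as both integrate test functions the same way. -/
theorem eq_pushUpdate [SFinite m] (hk : Measurable k) (hφ : Measurable φ) (μ P : Measure Z)
    [SFinite μ]
    (h : ∀ A, MeasurableSet A → P A = ∫⁻ u, ∫⁻ e, k (e, u) * A.indicator 1 (φ (e, u)) ∂m ∂μ) :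
    P = pushUpdate m k φ μ :=
  Measure.ext fun A hA => by rw [h A hA, pushUpdate_apply hk hφ μ hA]

end PushUpdate

/-! ### Normalization to probability measures -/

section Normalize

variable {Z : Type*} [MeasurableSpace Z]

theorem isProbabilityMeasure_normalize {P : Measure Z} (h0 : P Set.univ ≠ 0)
    (h1 : P Set.univ ≠ ∞) : IsProbabilityMeasure ((P Set.univ)⁻¹ • P) :=
  ⟨by simp [ENNReal.inv_mul_cancel h0 h1]⟩

theorem isProbabilityMeasure_posterior {Ft : Measure Z → Measure Z} {μ : Measure Z}
    (h0 : evidence Ft μ ≠ 0) (h1 : evidence Ft μ ≠ ∞) : IsProbabilityMeasure (posterior Ft μ) :=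
  isProbabilityMeasure_normalize h0 h1

end Normalize

/-! ### Propagation of errors along the sequence -/

/-- Error propagation: a distance with the triangle inequality for which the `i`-th update expands
by the factor `a i` at most. -/
theorem dist_truePosterior_le {Z : Type*} [MeasurableSpace Z] (d : Measure Z → Measure Z → ℝ)
    (Ft : ℕ → Measure Z → Measure Z) (P0 : Measure Z) (Q : ℕ → Measure Z) (hQ0 : Q 0 = P0)
    (a : ℕ → ℝ) (k : ℕ) (hk : 1 ≤ k)
    (htri : ∀ i ∈ Finset.Icc 1 k, d (truePosterior Ft P0 i) (Q i) ≤
      d (truePosterior Ft P0 i) (exactUpdate Ft Q i) + d (exactUpdate Ft Q i) (Q i))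
    (ha : ∀ i, 0 ≤ a i)
    (hstep : ∀ i ∈ Finset.Icc 2 k, d (truePosterior Ft P0 i) (exactUpdate Ft Q i) ≤
      a i * d (truePosterior Ft P0 (i - 1)) (Q (i - 1))) :
    d (truePosterior Ft P0 k) (Q k) ≤
      errorBound d (fun j => ∏ i ∈ Finset.Icc (j + 1) k, a i) Ft Q k := by
  induction k, hk using Nat.le_induction with
  | base =>
    -- As `Q 0 = P0`, step 1 propagates no earlier error; expansion is needed only from step 2 on.
    have h1 : exactUpdate Ft Q 1 = truePosterior Ft P0 1 := by
      simp [exactUpdate, truePosterior, hQ0]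
    simp [errorBound, h1]
  | succ n hn ih =>
    have ih' := ih (fun i hi => htri i (by simp at hi ⊢; omega))
      (fun i hi => hstep i (by simp at hi ⊢; omega))
    have h1 := htri (n + 1) (by simp)
    have h2 := hstep (n + 1) (by simp; omega)
    rw [Nat.add_sub_cancel] at h2
    refine h1.trans ((add_le_add_left (h2.trans (mul_le_mul_of_nonneg_left ih' (ha _))) _).trans
      (le_of_eq ?_))
    simp only [errorBound, Nat.add_sub_cancel]
    obtain ⟨l, rfl⟩ : ∃ l, n = l + 1 := ⟨n - 1, by omega⟩
    -- The last term of the old bound has coefficient 1; multiplied by the new factor it becomes the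
    -- top summand of the new sum.
    rw [Nat.add_sub_cancel, Finset.sum_Icc_succ_top (by omega)]
    simp only [Finset.Icc_self, Finset.prod_singleton]
    rw [mul_add, Finset.mul_sum]
    congr 2
    refine Finset.sum_congr rfl fun j hj => ?_
    simp only [Finset.mem_Icc] at hj
    rw [Finset.prod_Icc_succ_top (by omega : j + 1 ≤ l + 1 + 1)]
    ring

/-! ### Total variation: one-step estimate -/

section TotalVariation

variable {Z : Type*} [MeasurableSpace Z]

theorem abs_measureReal_sub_le_one (μ μ' : Measure Z) [IsProbabilityMeasure μ]
    [IsProbabilityMeasure μ'] (A : Set Z) : |μ.real A - μ'.real A| ≤ 1 :=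
  abs_sub_le_of_nonneg_of_le measureReal_nonneg measureReal_le_one measureReal_nonneg
    measureReal_le_one

theorem abs_measureReal_sub_le_tvDist (μ μ' : Measure Z) [IsProbabilityMeasure μ]
    [IsProbabilityMeasure μ'] {A : Set Z} (hA : MeasurableSet A) :
    |μ.real A - μ'.real A| ≤ tvDist μ μ' :=
  le_ciSup (f := fun A : {A : Set Z // MeasurableSet A} => |μ.real A - μ'.real A|)
    ⟨1, by rintro _ ⟨A, rfl⟩; exact abs_measureReal_sub_le_one μ μ' A⟩ ⟨A, hA⟩

theorem tvDist_le {μ μ' : Measure Z} {r : ℝ}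
    (h : ∀ A, MeasurableSet A → |μ.real A - μ'.real A| ≤ r) : tvDist μ μ' ≤ r :=
  haveI : Nonempty {A : Set Z // MeasurableSet A} := ⟨⟨∅, .empty⟩⟩
  ciSup_le fun A => h A A.2

theorem tvDist_comm (μ μ' : Measure Z) : tvDist μ μ' = tvDist μ' μ := by
  simp only [tvDist, abs_sub_comm]

theorem tvDist_triangle (μ₁ μ₂ μ₃ : Measure Z) [IsProbabilityMeasure μ₁]
    [IsProbabilityMeasure μ₂] [IsProbabilityMeasure μ₃] :
    tvDist μ₁ μ₃ ≤ tvDist μ₁ μ₂ + tvDist μ₂ μ₃ :=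
  tvDist_le fun A hA => (abs_sub_le _ (μ₂.real A) _).trans
    (add_le_add (abs_measureReal_sub_le_tvDist μ₁ μ₂ hA) (abs_measureReal_sub_le_tvDist μ₂ μ₃ hA))

/-- On a Hahn set `S` where `μ` dominates, replacing `f` by `C` only increases the difference of the
integrals; on the complement the difference is at most 0. What remains is `C * (μ S - μ' S)`. The
range `[0, C]` yields the factor `C`, where a bound on `|f|` alone would yield `2 * C`. -/
theorem integral_sub_integral_le_tvDist (μ μ' : Measure Z) [IsProbabilityMeasure μ]
    [IsProbabilityMeasure μ'] {f : Z → ℝ} (hf : Measurable f) {C : ℝ} (h0 : ∀ z, 0 ≤ f z)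
    (hC : ∀ z, f z ≤ C) : ∫ z, f z ∂μ - ∫ z, f z ∂μ' ≤ C * tvDist μ μ' := by
  have hint : ∀ (ρ : Measure Z) [IsFiniteMeasure ρ], Integrable f ρ := fun ρ _ =>
    Integrable.of_bound hf.aestronglyMeasurable C
      (Filter.Eventually.of_forall fun z => by rw [Real.norm_of_nonneg (h0 z)]; exact hC z)
  obtain ⟨S, hS, h1, h2⟩ := hahn_decomposition μ μ'
  have hle1 : μ'.restrict S ≤ μ.restrict S := Measure.le_iff.2 fun t ht => by
    rw [Measure.restrict_apply ht, Measure.restrict_apply ht]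
    exact h1 _ (ht.inter hS) Set.inter_subset_right
  have hle2 : μ.restrict Sᶜ ≤ μ'.restrict Sᶜ := Measure.le_iff.2 fun t ht => by
    rw [Measure.restrict_apply ht, Measure.restrict_apply ht]
    exact h2 _ (ht.inter hS.compl) Set.inter_subset_right
  have e1 : ∫ z in S, (C - f z) ∂μ' ≤ ∫ z in S, (C - f z) ∂μ :=
    integral_mono_measure hle1 (Filter.Eventually.of_forall fun z => sub_nonneg.2 (hC z))
      ((integrable_const C).sub (hint _))
  have e2 : ∫ z in Sᶜ, f z ∂μ ≤ ∫ z in Sᶜ, f z ∂μ' :=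
    integral_mono_measure hle2 (Filter.Eventually.of_forall h0) (hint _)
  rw [integral_sub (integrable_const C) (hint _), integral_sub (integrable_const C) (hint _)] at e1
  simp only [integral_const, measureReal_restrict_apply_univ, smul_eq_mul] at e1
  have e3 := integral_add_compl hS (hint μ)
  have e4 := integral_add_compl hS (hint μ')
  have e5 : (μ.real S - μ'.real S) ≤ tvDist μ μ' :=
    (le_abs_self _).trans (abs_measureReal_sub_le_tvDist μ μ' hS)
  obtain ⟨z⟩ : Nonempty Z := nonempty_of_isProbabilityMeasure μ
  have hCn : 0 ≤ C := (h0 z).trans (hC z)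
  have := mul_le_mul_of_nonneg_left e5 hCn
  linarith

variable {E : Type*} [MeasurableSpace E] {m : Measure E} {k : E × Z → ℝ≥0∞} {φ : E × Z → Z}

/-- Let `G A u` be the mass sent from `u` into `A`, and `a` the posterior probability of `A` under
the prior `μ'`. Then `G A - a * G univ` has integral 0 under `μ'`, and under `μ` its integral is
`Z1` times the difference of the two posterior probabilities. Only the evidence of `μ` enters. -/
theorem tvDist_normalize_pushUpdate_le [SFinite m] (hk : Measurable k) (hφ : Measurable φ)
    (μ μ' : Measure Z) [IsProbabilityMeasure μ] [IsProbabilityMeasure μ'] {C : ℝ≥0∞} (hC : C ≠ ∞)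
    (hkC : ∀ u, ∫⁻ e, k (e, u) ∂m ≤ C) {P P' : Measure Z} (hP : P = pushUpdate m k φ μ)
    (hP' : P' = pushUpdate m k φ μ') (h0 : P Set.univ ≠ 0)
    (h0' : P' Set.univ ≠ 0) :
    tvDist ((P Set.univ)⁻¹ • P) ((P' Set.univ)⁻¹ • P') ≤
      C.toReal / (P Set.univ).toReal * tvDist μ μ' := by
  set G : Set Z → Z → ℝ := fun A u => (∫⁻ e, k (e, u) * A.indicator 1 (φ (e, u)) ∂m).toReal
  have hGle : ∀ (A : Set Z) u, ∫⁻ e, k (e, u) * A.indicator 1 (φ (e, u)) ∂m ≤ ∫⁻ e, k (e, u) ∂m :=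
    fun A u => lintegral_mono fun e =>
      mul_le_of_le_one_right' (Set.indicator_apply_le' (fun _ => le_rfl) fun _ => zero_le)
  have hGm' : ∀ A, MeasurableSet A →
      Measurable fun u => ∫⁻ e, k (e, u) * A.indicator 1 (φ (e, u)) ∂m := fun A hA =>
    Measurable.lintegral_prod_left' (f := fun p : E × Z => k p * A.indicator 1 (φ p))
      (hk.mul ((measurable_one.indicator hA).comp hφ))
  have hGm : ∀ A, MeasurableSet A → Measurable (G A) := fun A hA => (hGm' A hA).ennreal_toReal
  have hG0 : ∀ A u, 0 ≤ G A u := fun A u => ENNReal.toReal_nonneg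
  have hG1 : ∀ A u, G A u ≤ G Set.univ u := fun A u => by
    refine ENNReal.toReal_mono ?_ ?_
    · exact ((hGle _ u).trans (hkC u)).trans_lt hC.lt_top |>.ne
    · simpa using hGle A u
  have hGC : ∀ A u, G A u ≤ C.toReal := fun A u =>
    ENNReal.toReal_mono hC ((hGle A u).trans (hkC u))
  have hint : ∀ (ρ : Measure Z) [IsProbabilityMeasure ρ] A, MeasurableSet A →
      Integrable (G A) ρ := fun ρ _ A hA =>
    Integrable.of_bound (hGm A hA).aestronglyMeasurable C.toReal
      (Filter.Eventually.of_forall fun z => by rw [Real.norm_of_nonneg (hG0 A z)]; exact hGC A z)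
  have hreal : ∀ (ρ : Measure Z) [IsProbabilityMeasure ρ] A, MeasurableSet A →
      (pushUpdate m k φ ρ A).toReal = ∫ u, G A u ∂ρ := fun ρ _ A hA => by
    rw [pushUpdate_apply hk hφ ρ hA, integral_toReal (hGm' A hA).aemeasurable]
    exact Filter.Eventually.of_forall fun u => ((hGle A u).trans (hkC u)).trans_lt hC.lt_top
  have hfin : ∀ (ρ : Measure Z) [IsProbabilityMeasure ρ], pushUpdate m k φ ρ Set.univ ≠ ∞ :=
    fun ρ _ => by
      rw [pushUpdate_univ hk hφ ρ]
      exact ((lintegral_mono hkC).trans_lt (by simpa using hC.lt_top)).ne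
  subst hP hP'
  have hZ : 0 < (pushUpdate m k φ μ Set.univ).toReal := ENNReal.toReal_pos h0 (hfin μ)
  have hZ' : 0 < (pushUpdate m k φ μ' Set.univ).toReal := ENNReal.toReal_pos h0' (hfin μ')
  refine tvDist_le fun A hA => ?_
  simp only [measureReal_def, Measure.smul_apply, smul_eq_mul, ENNReal.toReal_mul,
    ENNReal.toReal_inv, hreal _ A hA]
  set Z1 := (pushUpdate m k φ μ Set.univ).toReal
  set Z2 := (pushUpdate m k φ μ' Set.univ).toReal
  have hZ1 : Z1 = ∫ u, G Set.univ u ∂μ := hreal μ _ .univ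
  have hZ2 : Z2 = ∫ u, G Set.univ u ∂μ' := hreal μ' _ .univ
  set a := Z2⁻¹ * ∫ u, G A u ∂μ'
  have ha0 : 0 ≤ a := mul_nonneg (inv_nonneg.2 hZ'.le) (integral_nonneg (hG0 A))
  have ha1 : a ≤ 1 := by
    rw [inv_mul_le_one₀ hZ', hZ2]
    exact integral_mono (hint _ _ hA) (hint _ _ .univ) (hG1 A)
  -- `G A - a * G univ` lies in `[-a C, (1 - a) C]`; the shift by `a C` moves it into `[0, C]` and
  -- cancels in differences, both measures having mass 1.
  set f : Z → ℝ := fun u => G A u - a * G Set.univ u + a * C.toReal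
  have hfi : ∀ (ρ : Measure Z) [IsProbabilityMeasure ρ],
      ∫ u, f u ∂ρ = ∫ u, G A u ∂ρ - a * ∫ u, G Set.univ u ∂ρ + a * C.toReal := fun ρ _ => by
    have i1 := hint ρ A hA
    have i2 := (hint ρ Set.univ .univ).const_mul a
    have i3 : Integrable (fun u => G A u - a * G Set.univ u) ρ := i1.sub i2
    simp only [f]
    rw [integral_add i3 (integrable_const _), integral_sub i1 i2, integral_const_mul]
    simp
  have hfm : Measurable f := ((hGm A hA).sub ((hGm _ .univ).const_mul a)).add_const _
  have hf0 : ∀ u, 0 ≤ f u := fun u => by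
    have h1 := mul_le_mul_of_nonneg_left (hGC Set.univ u) ha0
    have h2 := hG0 A u
    simp only [f]; linarith
  have hf1 : ∀ u, f u ≤ C.toReal := fun u => by
    have h1 := mul_le_mul_of_nonneg_left (hGC Set.univ u) (sub_nonneg.2 ha1)
    have h2 := hG1 A u
    simp only [f]; linarith
  have k1 := integral_sub_integral_le_tvDist μ μ' hfm hf0 hf1
  have k2 := integral_sub_integral_le_tvDist μ' μ hfm hf0 hf1
  rw [tvDist_comm] at k2
  have hmid : ∫ u, f u ∂μ - ∫ u, f u ∂μ' = Z1 * (Z1⁻¹ * ∫ u, G A u ∂μ - a) := by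
    have e : ∫ u, G A u ∂μ' = a * Z2 := by simp only [a]; field_simp
    rw [hfi, hfi, ← hZ1, ← hZ2, e]; field_simp; ring
  have hmid' : |Z1 * (Z1⁻¹ * ∫ u, G A u ∂μ - a)| ≤ C.toReal * tvDist μ μ' := by
    rw [← hmid]; exact abs_le.2 ⟨by linarith, k1⟩
  rw [abs_mul, abs_of_pos hZ] at hmid'
  rw [div_mul_eq_mul_div, le_div_iff₀ hZ, mul_comm]
  exact hmid'

end TotalVariation

/-! ### The `L²` seminorm as a real number -/

section L2

variable {Z : Type*} [MeasurableSpace Z]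

theorem eLpNorm_two_sq (l : Measure Z) (u : Z → ℝ) :
    eLpNorm u 2 l ^ 2 = ∫⁻ z, ENNReal.ofReal (u z ^ 2) ∂l := by
  have h := eLpNorm_nnreal_pow_eq_lintegral (f := u) (μ := l) (p := 2) two_ne_zero
  simp only [NNReal.coe_ofNat, ENNReal.rpow_ofNat, ENNReal.coe_ofNat] at h
  rw [h]
  refine lintegral_congr fun z => ?_
  rw [← sq_abs, ENNReal.ofReal_pow (abs_nonneg _), Real.enorm_eq_ofReal_abs]

theorem integral_sq_eq_eLpNorm_sq (l : Measure Z) {u : Z → ℝ} (hu : AEStronglyMeasurable u l) :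
    ∫ z, u z ^ 2 ∂l = (eLpNorm u 2 l).toReal ^ 2 := by
  rw [← ENNReal.toReal_pow, eLpNorm_two_sq,
    integral_eq_lintegral_of_nonneg_ae (Filter.Eventually.of_forall fun z => sq_nonneg _) (hu.pow 2)]

theorem toReal_eLpNorm_add_le {l : Measure Z} {u v : Z → ℝ} (hu : MemLp u 2 l)
    (hv : MemLp v 2 l) :
    (eLpNorm (u + v) 2 l).toReal ≤ (eLpNorm u 2 l).toReal + (eLpNorm v 2 l).toReal := by
  rw [← ENNReal.toReal_add hu.2.ne hv.2.ne]
  exact ENNReal.toReal_mono (ENNReal.add_ne_top.2 ⟨hu.2.ne, hv.2.ne⟩)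
    (eLpNorm_add_le hu.1 hv.1 (by norm_num))

theorem toReal_eLpNorm_smul (l : Measure Z) (c : ℝ) (u : Z → ℝ) :
    (eLpNorm (c • u) 2 l).toReal = |c| * (eLpNorm u 2 l).toReal := by
  rw [eLpNorm_const_smul, ENNReal.toReal_mul, toReal_enorm, Real.norm_eq_abs]

end L2

/-! ### Hellinger distance through root densities; normalization -/

section RootDensity

variable {Z : Type*} [MeasurableSpace Z]

/-- The measure whose density with respect to `l` is `a ^ 2`. -/
noncomputable def withRootDensity (l : Measure Z) (a : Z → ℝ≥0) : Measure Z :=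
  l.withDensity fun z => (a z : ℝ≥0∞) ^ 2

instance (l : Measure Z) [SFinite l] (a : Z → ℝ≥0) : SFinite (withRootDensity l a) :=
  inferInstanceAs (SFinite (l.withDensity _))

theorem exists_eq_withRootDensity {μ l : Measure Z} [IsFiniteMeasure μ] [SigmaFinite l]
    (h : μ ≪ l) : ∃ a : Z → ℝ≥0, Measurable a ∧ μ = withRootDensity l a := by
  refine ⟨fun z => NNReal.sqrt (μ.rnDeriv l z).toNNReal,
    NNReal.continuous_sqrt.measurable.comp (Measure.measurable_rnDeriv μ l).ennreal_toNNReal, ?_⟩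
  rw [withRootDensity]
  nth_rewrite 1 [← Measure.withDensity_rnDeriv_eq μ l h]
  refine withDensity_congr_ae ?_
  filter_upwards [Measure.rnDeriv_lt_top μ l] with z hz
  rw [← ENNReal.coe_pow, NNReal.sq_sqrt, ENNReal.coe_toNNReal hz.ne]

theorem withRootDensity_univ (l : Measure Z) (a : Z → ℝ≥0) :
    withRootDensity l a Set.univ = eLpNorm (fun z => (a z : ℝ)) 2 l ^ 2 := by
  rw [withRootDensity, withDensity_apply _ .univ, Measure.restrict_univ, eLpNorm_two_sq]
  refine lintegral_congr fun z => ?_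
  rw [ENNReal.ofReal_pow (by positivity), ENNReal.ofReal_coe_nnreal]

theorem memLp_root {l : Measure Z} {a : Z → ℝ≥0} (ha : Measurable a)
    (h : withRootDensity l a Set.univ ≠ ∞) : MemLp (fun z => (a z : ℝ)) 2 l := by
  refine ⟨ha.coe_nnreal_real.aestronglyMeasurable, ?_⟩
  rw [withRootDensity_univ] at h
  by_contra h'
  rw [not_lt_top_iff] at h'
  simp [h'] at h

theorem smul_withRootDensity (l : Measure Z) {a : Z → ℝ≥0} (ha : Measurable a) (c : ℝ≥0) :
    (c : ℝ≥0∞) ^ 2 • withRootDensity l a = withRootDensity l (fun z => c * a z) := by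
  rw [withRootDensity, withRootDensity, ← withDensity_smul _ (by fun_prop)]
  congr 1
  ext z
  simp [mul_pow]

theorem mul_sq_sqrt_div_sub_sqrt_div (a b : ℝ≥0) :
    ((a ^ 2 + b ^ 2 : ℝ≥0) : ℝ) * (√((a ^ 2 / (a ^ 2 + b ^ 2) : ℝ≥0) : ℝ) -
      √((b ^ 2 / (a ^ 2 + b ^ 2) : ℝ≥0) : ℝ)) ^ 2 = ((a : ℝ) - b) ^ 2 := by
  push_cast
  rw [Real.sqrt_div (by positivity), Real.sqrt_div (by positivity), Real.sqrt_sq a.coe_nonneg,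
    Real.sqrt_sq b.coe_nonneg]
  rcases eq_or_lt_of_le (show (0 : ℝ) ≤ (a : ℝ) ^ 2 + (b : ℝ) ^ 2 by positivity) with h | h
  · have ha : (a : ℝ) = 0 := by nlinarith [sq_nonneg (a : ℝ), sq_nonneg (b : ℝ)]
    have hb : (b : ℝ) = 0 := by nlinarith [sq_nonneg (a : ℝ), sq_nonneg (b : ℝ)]
    simp [ha, hb]
  · have hs := Real.sq_sqrt h.le
    have hp := Real.sqrt_pos.2 h
    rw [← sub_div, div_pow, hs]
    field_simp

/-- The Hellinger distance does not depend on the dominating measure. -/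
theorem hellingerDist_withRootDensity (l : Measure Z) {a b : Z → ℝ≥0} (ha : Measurable a)
    (hb : Measurable b) [IsFiniteMeasure (withRootDensity l a)]
    [IsFiniteMeasure (withRootDensity l b)] :
    hellingerDist (withRootDensity l a) (withRootDensity l b) =
      √(1 / 2) * (eLpNorm (fun z => (a z : ℝ) - b z) 2 l).toReal := by
  set μ := withRootDensity l a
  set μ' := withRootDensity l b
  set s : Z → ℝ≥0 := fun z => a z ^ 2 + b z ^ 2
  have hsm : Measurable s := (ha.pow_const 2).add (hb.pow_const 2)
  have hρ : μ + μ' = l.withDensity fun z => (s z : ℝ≥0∞) := by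
    rw [show (fun z => (s z : ℝ≥0∞)) = (fun z => (a z : ℝ≥0∞) ^ 2) + fun z => (b z : ℝ≥0∞) ^ 2 by
      ext z; simp [s]]
    rw [withDensity_add_left (by fun_prop)]
    rfl
  have hden : ∀ c : Z → ℝ≥0, Measurable c → (∀ z, s z = 0 → c z = 0) →
      (withRootDensity l c).rnDeriv (μ + μ') =ᵐ[μ + μ'] fun z => ((c z ^ 2 / s z : ℝ≥0) : ℝ≥0∞) := by
    intro c hc hcs
    have hm : Measurable fun z => ((c z ^ 2 / s z : ℝ≥0) : ℝ≥0∞) :=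
      ((hc.pow_const 2).div hsm).coe_nnreal_ennreal
    have : withRootDensity l c = (μ + μ').withDensity fun z => ((c z ^ 2 / s z : ℝ≥0) : ℝ≥0∞) := by
      rw [hρ, ← withDensity_mul _ hsm.coe_nnreal_ennreal hm, withRootDensity]
      congr 1
      ext z
      rw [Pi.mul_apply, ← ENNReal.coe_mul, ← ENNReal.coe_pow]
      congr 1
      -- Where `s` vanishes the quotient is 0 by convention, which is the right value since `c`
      -- vanishes there too.
      by_cases h : s z = 0
      · simp [h, hcs z h]
      · rw [mul_div_cancel₀ _ h]
    rw [this]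
    exact Measure.rnDeriv_withDensity _ hm
  have h1 := hden a ha fun z h => by simpa using (add_eq_zero.1 h).1
  have h2 := hden b hb fun z h => by simpa using (add_eq_zero.1 h).2
  rw [hellingerDist, Real.sqrt_mul (by norm_num)]
  congr 1
  have : ∫ z, (√(μ.rnDeriv (μ + μ') z).toReal - √(μ'.rnDeriv (μ + μ') z).toReal) ^ 2 ∂(μ + μ') =
      ∫ z, ((a z : ℝ) - b z) ^ 2 ∂l := by
    calc _ = ∫ z, (√((a z ^ 2 / s z : ℝ≥0) : ℝ) - √((b z ^ 2 / s z : ℝ≥0) : ℝ)) ^ 2 ∂(μ + μ') := by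
          refine integral_congr_ae ?_
          filter_upwards [h1, h2] with z e1 e2
          rw [e1, e2, ENNReal.coe_toReal, ENNReal.coe_toReal]
      _ = _ := by
          rw [hρ, integral_withDensity_eq_integral_smul hsm]
          refine integral_congr_ae (Filter.Eventually.of_forall fun z => ?_)
          exact mul_sq_sqrt_div_sub_sqrt_div (a z) (b z)
  have hab : Measurable fun z => (a z : ℝ) - b z := ha.coe_nnreal_real.sub hb.coe_nnreal_real
  rw [this, integral_sq_eq_eLpNorm_sq l hab.aestronglyMeasurable, Real.sqrt_sq ENNReal.toReal_nonneg]

theorem hellingerDist_comm (μ μ' : Measure Z) : hellingerDist μ μ' = hellingerDist μ' μ := by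
  simp only [hellingerDist, add_comm μ' μ]
  congr 2
  exact integral_congr_ae (Filter.Eventually.of_forall fun z => sub_sq_comm _ _)

/-- The three measures have root densities with respect to their sum, where the claim is Minkowski's
inequality in `L²`. -/
theorem hellingerDist_triangle (μ₁ μ₂ μ₃ : Measure Z) [IsFiniteMeasure μ₁]
    [IsFiniteMeasure μ₂] [IsFiniteMeasure μ₃] :
    hellingerDist μ₁ μ₃ ≤ hellingerDist μ₁ μ₂ + hellingerDist μ₂ μ₃ := by
  set l := μ₁ + μ₂ + μ₃
  obtain ⟨a, ha, h1⟩ := exists_eq_withRootDensity (μ := μ₁) (l := l)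
    (Measure.absolutelyContinuous_of_le (Measure.le_add_right (Measure.le_add_right le_rfl)))
  obtain ⟨b, hb, h2⟩ := exists_eq_withRootDensity (μ := μ₂) (l := l)
    (Measure.absolutelyContinuous_of_le (Measure.le_add_right (Measure.le_add_left le_rfl)))
  obtain ⟨c, hc, h3⟩ := exists_eq_withRootDensity (μ := μ₃) (l := l)
    (Measure.absolutelyContinuous_of_le (Measure.le_add_left le_rfl))
  have i1 : IsFiniteMeasure (withRootDensity l a) := h1 ▸ inferInstance
  have i2 : IsFiniteMeasure (withRootDensity l b) := h2 ▸ inferInstance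
  have i3 : IsFiniteMeasure (withRootDensity l c) := h3 ▸ inferInstance
  have la := memLp_root ha (measure_ne_top (withRootDensity l a) _)
  have lb := memLp_root hb (measure_ne_top (withRootDensity l b) _)
  have lc := memLp_root hc (measure_ne_top (withRootDensity l c) _)
  rw [h1, h2, h3, hellingerDist_withRootDensity l ha hb, hellingerDist_withRootDensity l hb hc,
    hellingerDist_withRootDensity l ha hc, ← mul_add]
  refine mul_le_mul_of_nonneg_left ?_ (Real.sqrt_nonneg _)
  have := toReal_eLpNorm_add_le (la.sub lb) (lb.sub lc)
  rwa [sub_add_sub_cancel] at this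

/-- Normalizing two finite measures at most doubles their Hellinger distance, up to scaling. -/
theorem hellingerDist_normalize_le (P P' : Measure Z) [IsFiniteMeasure P] [IsFiniteMeasure P']
    (h0 : P Set.univ ≠ 0) (h0' : P' Set.univ ≠ 0) :
    hellingerDist ((P Set.univ)⁻¹ • P) ((P' Set.univ)⁻¹ • P') ≤
      2 / √(P Set.univ).toReal * hellingerDist P P' := by
  obtain ⟨p, hp, hP⟩ := exists_eq_withRootDensity (μ := P) (l := P + P')
    (Measure.absolutelyContinuous_of_le (Measure.le_add_right le_rfl))
  obtain ⟨q, hq, hP'⟩ := exists_eq_withRootDensity (μ := P') (l := P + P')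
    (Measure.absolutelyContinuous_of_le (Measure.le_add_left le_rfl))
  set l := P + P'
  have i1 : IsFiniteMeasure (withRootDensity l p) := hP ▸ inferInstance
  have i2 : IsFiniteMeasure (withRootDensity l q) := hP' ▸ inferInstance
  have lp := memLp_root hp (measure_ne_top (withRootDensity l p) _)
  have lq := memLp_root hq (measure_ne_top (withRootDensity l q) _)
  set N : (Z → ℝ) → ℝ := fun u => (eLpNorm u 2 l).toReal
  have hNp : √(P Set.univ).toReal = N fun z => (p z : ℝ) := by
    rw [hP, withRootDensity_univ, ENNReal.toReal_pow, Real.sqrt_sq ENNReal.toReal_nonneg]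
  have hNq : √(P' Set.univ).toReal = N fun z => (q z : ℝ) := by
    rw [hP', withRootDensity_univ, ENNReal.toReal_pow, Real.sqrt_sq ENNReal.toReal_nonneg]
  have pos : 0 < √(P Set.univ).toReal :=
    Real.sqrt_pos.2 (ENNReal.toReal_pos h0 (measure_ne_top _ _))
  have pos' : 0 < √(P' Set.univ).toReal :=
    Real.sqrt_pos.2 (ENNReal.toReal_pos h0' (measure_ne_top _ _))
  have hsm : ∀ (R : Measure Z) (r : Z → ℝ≥0), Measurable r → R Set.univ ≠ 0 → R Set.univ ≠ ∞ →
      R = withRootDensity l r → (R Set.univ)⁻¹ • R =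
        withRootDensity l (fun z => (NNReal.sqrt (R Set.univ).toNNReal)⁻¹ * r z) := by
    intro R r hr hR0 hR1 hR
    rw [← smul_withRootDensity l hr, ← hR, ← ENNReal.coe_pow, inv_pow, NNReal.sq_sqrt,
      ENNReal.coe_inv (by simp [ENNReal.toNNReal_eq_zero_iff, hR0, hR1]), ENNReal.coe_toNNReal hR1]
  have e1 := hsm P p hp h0 (measure_ne_top _ _) hP
  have e2 := hsm P' q hq h0' (measure_ne_top _ _) hP'
  have j1 := isProbabilityMeasure_normalize h0 (measure_ne_top _ _)
  have j2 := isProbabilityMeasure_normalize h0' (measure_ne_top _ _)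
  set c := (NNReal.sqrt (P Set.univ).toNNReal)⁻¹
  set c' := (NNReal.sqrt (P' Set.univ).toNNReal)⁻¹
  have hc : (c : ℝ) = (N fun z => (p z : ℝ))⁻¹ := by
    rw [← hNp]; simp [c, NNReal.coe_inv, Real.coe_sqrt]; rfl
  have hc' : (c' : ℝ) = (N fun z => (q z : ℝ))⁻¹ := by
    rw [← hNq]; simp [c', NNReal.coe_inv, Real.coe_sqrt]; rfl
  rw [hNp] at pos ⊢
  rw [hNq] at pos'
  have hPP : hellingerDist P P' = √(1 / 2) * N fun z => (p z : ℝ) - q z := by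
    rw [hP, hP']; exact hellingerDist_withRootDensity l hp hq
  have hnn : hellingerDist ((P Set.univ)⁻¹ • P) ((P' Set.univ)⁻¹ • P') =
      √(1 / 2) * N fun z => ((c * p z : ℝ≥0) : ℝ) - (c' * q z : ℝ≥0) := by
    rw [e1] at j1 ⊢
    rw [e2] at j2 ⊢
    exact hellingerDist_withRootDensity l (hp.const_mul c) (hq.const_mul c')
  rw [hPP, hnn, mul_left_comm]
  refine mul_le_mul_of_nonneg_left ?_ (Real.sqrt_nonneg _)
  -- The difference is split so that the second error multiplies `q`, whose norm will cancel the `1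
  -- / B` in `A⁻¹ - B⁻¹`.
  have hsplit : (fun z => ((c * p z : ℝ≥0) : ℝ) - (c' * q z : ℝ≥0)) =
      (c : ℝ) • (fun z => (p z : ℝ) - q z) + ((c : ℝ) - c') • fun z => (q z : ℝ) := by
    ext z; simp; ring
  have hlpq : MemLp (fun z => (p z : ℝ) - q z) 2 l := lp.sub lq
  have t1 := toReal_eLpNorm_add_le (hlpq.const_smul (c : ℝ)) (lq.const_smul ((c : ℝ) - c'))
  rw [← hsplit, toReal_eLpNorm_smul, toReal_eLpNorm_smul] at t1
  have t2 : (N fun z => (p z : ℝ)) ≤ (N fun z => (p z : ℝ) - q z) + N fun z => (q z : ℝ) := by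
    have e : (fun z => (p z : ℝ) - q z) + (fun z => (q z : ℝ)) = fun z => (p z : ℝ) := by
      ext z; simp
    exact e ▸ toReal_eLpNorm_add_le hlpq lq
  have t3 : (N fun z => (q z : ℝ)) ≤ (N fun z => (p z : ℝ) - q z) + N fun z => (p z : ℝ) := by
    have := toReal_eLpNorm_add_le (hlpq.const_smul (-1 : ℝ)) lp
    have e : (-1 : ℝ) • (fun z => (p z : ℝ) - q z) + (fun z => (p z : ℝ)) =
        fun z => (q z : ℝ) := by
      ext z; simp
    rwa [toReal_eLpNorm_smul, abs_neg, abs_one, one_mul, e] at this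
  change (N fun z => ((c * p z : ℝ≥0) : ℝ) - (c' * q z : ℝ≥0)) ≤ |(c : ℝ)| *
    (N fun z => (p z : ℝ) - q z) + |(c : ℝ) - c'| * (N fun z => (q z : ℝ)) at t1
  refine t1.trans ?_
  rw [hc, hc']
  set A := N fun z => (p z : ℝ)
  set B := N fun z => (q z : ℝ)
  set Δ := N fun z => (p z : ℝ) - q z
  rw [abs_of_pos (inv_pos.2 pos)]
  have : |A⁻¹ - B⁻¹| * B = A⁻¹ * |B - A| := by
    rw [inv_sub_inv pos.ne' pos'.ne', abs_div, abs_of_pos (mul_pos pos pos')]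
    field_simp
  rw [this, ← mul_add, div_mul_eq_mul_div, inv_mul_eq_div]
  refine div_le_div_of_nonneg_right ?_ pos.le
  -- The reverse triangle inequality; the factor 2 is one `Δ` from the root densities and one from
  -- the normalizing constants.
  have : |B - A| ≤ Δ := abs_le.2 ⟨by linarith, by linarith⟩
  linarith

end RootDensity

/-! ### Hellinger distance under an unnormalized update -/

section DataProcessing

variable {E Z : Type*} [MeasurableSpace E] [MeasurableSpace Z] {m : Measure E}
  {k : E × Z → ℝ≥0∞} {φ : E × Z → Z}

/-- Weighted AM-GM. The weights 0 and `∞` are allowed so that `t` may be a quotient of densities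
with zeros. -/
theorem two_mul_coe_mul_le (x y : ℝ≥0) (t : ℝ≥0∞) :
    2 * ((x : ℝ≥0∞) * y) ≤ t * (x : ℝ≥0∞) ^ 2 + t⁻¹ * (y : ℝ≥0∞) ^ 2 := by
  rcases eq_or_ne x 0 with rfl | hx
  · simp
  rcases eq_or_ne y 0 with rfl | hy
  · simp
  rcases eq_or_ne t 0 with rfl | ht
  · rw [ENNReal.inv_zero, ENNReal.top_mul (by simpa using hy), add_top]
    exact le_top
  rcases eq_or_ne t ∞ with rfl | ht'
  · rw [ENNReal.top_mul (by simpa using hx), top_add]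
    exact le_top
  lift t to ℝ≥0 using ht'
  have ht0 : t ≠ 0 := by simpa using ht
  rw [← ENNReal.coe_inv ht0]
  norm_cast
  rw [← NNReal.coe_le_coe]
  push_cast
  have h : 0 < (t : ℝ) := by positivity
  have e : (t : ℝ) * x ^ 2 + (t : ℝ)⁻¹ * y ^ 2 - 2 * (x * y) = (t : ℝ)⁻¹ * (t * x - y) ^ 2 := by
    field_simp; ring
  have : 0 ≤ (t : ℝ)⁻¹ * (t * x - y) ^ 2 := by positivity
  linarith

/-- Equality in AM-GM at the weight `b / a`. The conventions for division by 0 and for `0 * ∞` make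
it hold at zeros as well, so no exceptional set is needed. -/
theorem sq_mul_div_add_sq_mul_inv (a b : ℝ≥0) :
    (a : ℝ≥0∞) ^ 2 * (b / a) + (b : ℝ≥0∞) ^ 2 * ((b : ℝ≥0∞) / a)⁻¹ = 2 * (a * b) := by
  rcases eq_or_ne a 0 with rfl | ha
  · rcases eq_or_ne b 0 with rfl | hb
    · simp
    · simp [ENNReal.div_zero, hb]
  rcases eq_or_ne b 0 with rfl | hb
  · simp
  rw [← ENNReal.coe_div ha, ← ENNReal.coe_inv (div_ne_zero hb ha)]
  norm_cast
  field_simp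
  ring

/-- Splits total mass into squared distance and affinity without subtracting in `ℝ≥0∞`. -/
theorem coe_sq_add_coe_sq (a b : ℝ≥0) :
    (a : ℝ≥0∞) ^ 2 + (b : ℝ≥0∞) ^ 2 =
      ENNReal.ofReal (((a : ℝ) - b) ^ 2) + 2 * ((a : ℝ≥0∞) * b) := by
  have h : 2 * ((a : ℝ≥0∞) * b) = ENNReal.ofReal (2 * (a * b)) := by
    rw [ENNReal.ofReal_mul (by norm_num), ENNReal.ofReal_mul a.coe_nonneg]; simp
  have h2 : (a : ℝ≥0∞) ^ 2 + (b : ℝ≥0∞) ^ 2 = ENNReal.ofReal (a ^ 2 + b ^ 2) := by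
    rw [ENNReal.ofReal_add (by positivity) (by positivity), ENNReal.ofReal_pow a.coe_nonneg,
      ENNReal.ofReal_pow b.coe_nonneg]; simp
  rw [h, h2, ← ENNReal.ofReal_add (by positivity) (by positivity)]
  congr 1; ring

/-- The affinity of two measures does not decrease under a (sub-Markov) kernel. -/
theorem lintegral_mul_root_le [SFinite m] (hk : Measurable k) (hφ : Measurable φ)
    (l L : Measure Z) [SFinite l] {a b p q : Z → ℝ≥0} (ha : Measurable a) (hb : Measurable b)
    (hp : Measurable p) (hq : Measurable q)
    (hP : pushUpdate m k φ (withRootDensity l a) = withRootDensity L p)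
    (hQ : pushUpdate m k φ (withRootDensity l b) = withRootDensity L q) :
    ∫⁻ u, (∫⁻ e, k (e, u) ∂m) * (2 * ((a u : ℝ≥0∞) * b u)) ∂l ≤
      ∫⁻ z, 2 * ((p z : ℝ≥0∞) * q z) ∂L := by
  -- AM-GM is applied before the update with the weight `t ∘ φ`. Its two terms integrate to `∫ p² t`
  -- and `∫ q² / t` after the update, where this `t` gives exactly `∫ 2 p q`.
  set t : Z → ℝ≥0∞ := fun z => (q z : ℝ≥0∞) / p z
  have ht : Measurable t := hq.coe_nnreal_ennreal.div hp.coe_nnreal_ennreal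
  have key : ∀ (c r : Z → ℝ≥0) (g : Z → ℝ≥0∞), Measurable c → Measurable r → Measurable g →
      pushUpdate m k φ (withRootDensity l c) = withRootDensity L r →
      ∫⁻ u, ∫⁻ e, k (e, u) * (g (φ (e, u)) * (c u : ℝ≥0∞) ^ 2) ∂m ∂l =
        ∫⁻ z, (r z : ℝ≥0∞) ^ 2 * g z ∂L := by
    intro c r g hc hr hg h
    have e1 := lintegral_pushUpdate hk hφ (withRootDensity l c)
      (hg := hg) (g := g) (m := m)
    have hin : Measurable fun u => ∫⁻ e, k (e, u) * g (φ (e, u)) ∂m :=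
      Measurable.lintegral_prod_left' (f := fun p : E × Z => k p * g (φ p))
        (hk.mul (hg.comp hφ))
    rw [h, withRootDensity, withRootDensity,
      lintegral_withDensity_eq_lintegral_mul _ (by fun_prop) hg,
      lintegral_withDensity_eq_lintegral_mul _ (by fun_prop) hin] at e1
    simp only [Pi.mul_apply] at e1
    rw [e1]
    refine lintegral_congr fun u => ?_
    rw [← lintegral_const_mul]
    · refine lintegral_congr fun e => by ring
    · exact (hk.mul (hg.comp hφ)).comp measurable_prodMk_right
  have h1 := key a p t ha hp ht hP
  have h2 := key b q (fun z => (t z)⁻¹) hb hq ht.inv hQ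
  calc _ ≤ ∫⁻ u, (∫⁻ e, k (e, u) * (t (φ (e, u)) * (a u : ℝ≥0∞) ^ 2) ∂m) +
        ∫⁻ e, k (e, u) * ((t (φ (e, u)))⁻¹ * (b u : ℝ≥0∞) ^ 2) ∂m ∂l := by
        refine lintegral_mono fun u => ?_
        have hku : Measurable fun e => k (e, u) := hk.comp measurable_prodMk_right
        rw [← lintegral_mul_const _ hku, ← lintegral_add_left]
        · refine lintegral_mono fun e => ?_
          rw [← mul_add]
          exact mul_le_mul_right (two_mul_coe_mul_le _ _ _) _
        · exact (hk.comp measurable_prodMk_right).mul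
            ((ht.comp (hφ.comp measurable_prodMk_right)).mul_const _)
    _ = _ := by
        rw [lintegral_add_left, h1, h2, ← lintegral_add_left]
        · exact lintegral_congr fun z => sq_mul_div_add_sq_mul_inv (p z) (q z)
        · fun_prop
        · refine Measurable.lintegral_prod_left'
            (f := fun p : E × Z => k p * (t (φ p) * (a p.2 : ℝ≥0∞) ^ 2)) ?_
          exact hk.mul ((ht.comp hφ).mul (by fun_prop))

theorem isFiniteMeasure_pushUpdate [SFinite m] (hk : Measurable k) (hφ : Measurable φ)
    {C : ℝ≥0∞} (hC : C ≠ ∞) (hkC : ∀ u, ∫⁻ e, k (e, u) ∂m ≤ C) (μ : Measure Z)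
    [IsFiniteMeasure μ] : IsFiniteMeasure (pushUpdate m k φ μ) := by
  refine ⟨?_⟩
  rw [pushUpdate_univ hk hφ μ]
  refine (lintegral_mono hkC).trans_lt ?_
  rw [lintegral_const]
  exact ENNReal.mul_lt_top hC.lt_top (measure_lt_top μ _)

/-- The total output mass `L univ` has two decompositions into squared distance plus affinity, one
before the update (weighted by the mass `I u` sent from `u`) and one after. As the affinity does not
drop, the squared distance does not exceed its weighted value before the update, and `I ≤ C`. -/
theorem hellingerDist_pushUpdate_le [SFinite m] (hk : Measurable k) (hφ : Measurable φ)
    (μ μ' : Measure Z) [IsFiniteMeasure μ] [IsFiniteMeasure μ'] {C : ℝ≥0∞} (hC : C ≠ ∞)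
    (hkC : ∀ u, ∫⁻ e, k (e, u) ∂m ≤ C) :
    hellingerDist (pushUpdate m k φ μ) (pushUpdate m k φ μ') ≤
      √C.toReal * hellingerDist μ μ' := by
  obtain ⟨a, ha, hμ⟩ := exists_eq_withRootDensity (μ := μ) (l := μ + μ')
    (Measure.absolutelyContinuous_of_le (Measure.le_add_right le_rfl))
  obtain ⟨b, hb, hμ'⟩ := exists_eq_withRootDensity (μ := μ') (l := μ + μ')
    (Measure.absolutelyContinuous_of_le (Measure.le_add_left le_rfl))
  set l := μ + μ'
  have f1 := isFiniteMeasure_pushUpdate hk hφ hC hkC μ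
  have f2 := isFiniteMeasure_pushUpdate hk hφ hC hkC μ'
  obtain ⟨p, hp, hP⟩ := exists_eq_withRootDensity (μ := pushUpdate m k φ μ)
    (l := pushUpdate m k φ μ + pushUpdate m k φ μ')
    (Measure.absolutelyContinuous_of_le (Measure.le_add_right le_rfl))
  obtain ⟨q, hq, hQ⟩ := exists_eq_withRootDensity (μ := pushUpdate m k φ μ')
    (l := pushUpdate m k φ μ + pushUpdate m k φ μ')
    (Measure.absolutelyContinuous_of_le (Measure.le_add_left le_rfl))
  set L := pushUpdate m k φ μ + pushUpdate m k φ μ'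
  have i1 : IsFiniteMeasure (withRootDensity l a) := hμ ▸ inferInstance
  have i2 : IsFiniteMeasure (withRootDensity l b) := hμ' ▸ inferInstance
  have i3 : IsFiniteMeasure (withRootDensity L p) := hP ▸ inferInstance
  have i4 : IsFiniteMeasure (withRootDensity L q) := hQ ▸ inferInstance
  have aff := lintegral_mul_root_le hk hφ l L ha hb hp hq (by rw [← hμ, hP]) (by rw [← hμ', hQ])
  have hh : hellingerDist μ μ' = √(1 / 2) * (eLpNorm (fun z => (a z : ℝ) - b z) 2 l).toReal := by
    rw [hμ, hμ']; exact hellingerDist_withRootDensity l ha hb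
  rw [hh, hP, hQ, hellingerDist_withRootDensity L hp hq, mul_left_comm]
  refine mul_le_mul_of_nonneg_left ?_ (Real.sqrt_nonneg _)
  set I : Z → ℝ≥0∞ := fun u => ∫⁻ e, k (e, u) ∂m
  have hI : Measurable I := Measurable.lintegral_prod_left' hk
  have mass : ∀ c : Z → ℝ≥0, Measurable c → pushUpdate m k φ (withRootDensity l c) Set.univ =
      ∫⁻ u, I u * (c u : ℝ≥0∞) ^ 2 ∂l := fun c hc => by
    rw [pushUpdate_univ hk hφ, withRootDensity,
      lintegral_withDensity_eq_lintegral_mul _ (by fun_prop) hI]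
    exact lintegral_congr fun u => mul_comm _ _
  have mass' : ∀ c : Z → ℝ≥0, withRootDensity L c Set.univ = ∫⁻ z, (c z : ℝ≥0∞) ^ 2 ∂L :=
    fun c => by rw [withRootDensity, withDensity_apply _ .univ, Measure.restrict_univ]
  have s1 : L Set.univ = ∫⁻ u, I u * ENNReal.ofReal (((a u : ℝ) - b u) ^ 2) ∂l +
      ∫⁻ u, I u * (2 * ((a u : ℝ≥0∞) * b u)) ∂l := by
    have : L Set.univ = pushUpdate m k φ (withRootDensity l a) Set.univ +
        pushUpdate m k φ (withRootDensity l b) Set.univ := by rw [← hμ, ← hμ']; rfl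
    rw [this, mass a ha, mass b hb, ← lintegral_add_left (by fun_prop),
      ← lintegral_add_left (by fun_prop)]
    refine lintegral_congr fun u => ?_
    rw [← mul_add, ← mul_add, coe_sq_add_coe_sq]
  have s2 : L Set.univ = ∫⁻ z, ENNReal.ofReal (((p z : ℝ) - q z) ^ 2) ∂L +
      ∫⁻ z, 2 * ((p z : ℝ≥0∞) * q z) ∂L := by
    have : L Set.univ = withRootDensity L p Set.univ + withRootDensity L q Set.univ := by
      rw [← hP, ← hQ]; rfl
    rw [this, mass', mass', ← lintegral_add_left (by fun_prop),
      ← lintegral_add_left (by fun_prop)]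
    exact lintegral_congr fun z => coe_sq_add_coe_sq _ _
  have hLfin : L Set.univ ≠ ∞ := measure_ne_top _ _
  have hAfin : ∫⁻ u, I u * (2 * ((a u : ℝ≥0∞) * b u)) ∂l ≠ ∞ := fun h => by
    rw [h, add_top] at s1; exact hLfin s1
  have s3 : ∫⁻ z, ENNReal.ofReal (((p z : ℝ) - q z) ^ 2) ∂L ≤
      ∫⁻ u, I u * ENNReal.ofReal (((a u : ℝ) - b u) ^ 2) ∂l := by
    -- Adding the finite affinity to both sides turns the right one into `L univ`, to which `aff`
    -- applies.
    refine (ENNReal.add_le_add_iff_right hAfin).1 ?_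
    rw [← s1, s2]
    exact add_le_add_right aff _
  have s4 : ∫⁻ u, I u * ENNReal.ofReal (((a u : ℝ) - b u) ^ 2) ∂l ≤
      C * ∫⁻ u, ENNReal.ofReal (((a u : ℝ) - b u) ^ 2) ∂l := by
    rw [← lintegral_const_mul' _ _ hC]
    exact lintegral_mono fun u => mul_le_mul_left (hkC u) _
  have s5 := s3.trans s4
  rw [← eLpNorm_two_sq L fun z => (p z : ℝ) - q z, ← eLpNorm_two_sq l fun z => (a z : ℝ) - b z] at s5
  have lab : MemLp (fun z => (a z : ℝ) - b z) 2 l :=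
    (memLp_root ha (measure_ne_top (withRootDensity l a) _)).sub
      (memLp_root hb (measure_ne_top (withRootDensity l b) _))
  have s6 := ENNReal.toReal_mono (ENNReal.mul_ne_top hC (ENNReal.pow_ne_top lab.2.ne)) s5
  rw [ENNReal.toReal_pow, ENNReal.toReal_mul, ENNReal.toReal_pow] at s6
  refine (sq_le_sq₀ ENNReal.toReal_nonneg (by positivity)).1 ?_
  rw [mul_pow, Real.sq_sqrt ENNReal.toReal_nonneg]
  exact s6

theorem hellingerDist_normalize_pushUpdate_le [SFinite m] (hk : Measurable k) (hφ : Measurable φ)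
    (μ μ' : Measure Z) [IsProbabilityMeasure μ] [IsProbabilityMeasure μ'] {C : ℝ≥0∞} (hC : C ≠ ∞)
    (hkC : ∀ u, ∫⁻ e, k (e, u) ∂m ≤ C) {P P' : Measure Z} (hP : P = pushUpdate m k φ μ)
    (hP' : P' = pushUpdate m k φ μ') (h0 : P Set.univ ≠ 0) (h0' : P' Set.univ ≠ 0) :
    hellingerDist ((P Set.univ)⁻¹ • P) ((P' Set.univ)⁻¹ • P') ≤
      2 * √C.toReal / √(P Set.univ).toReal * hellingerDist μ μ' := by
  have f1 : IsFiniteMeasure P := hP ▸ isFiniteMeasure_pushUpdate hk hφ hC hkC μ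
  have f2 : IsFiniteMeasure P' := hP' ▸ isFiniteMeasure_pushUpdate hk hφ hC hkC μ'
  refine (hellingerDist_normalize_le P P' h0 h0').trans ?_
  rw [mul_div_right_comm, mul_assoc]
  refine mul_le_mul_of_nonneg_left ?_ (by positivity)
  rw [hP, hP']
  exact hellingerDist_pushUpdate_le hk hφ μ μ' hC hkC

end DataProcessing

/-! ### Optimal transport: gluing, completion, one-step estimate -/

section Transport

variable {Z : Type*} [MeasurableSpace Z]

/-- The optimal transport cost for the cost function `c`. -/
noncomputable def transportCost (c : Z × Z → ℝ≥0∞) (μ μ' : Measure Z) : ℝ≥0∞ :=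
  ⨅ γ ∈ couplings μ μ', ∫⁻ p, c p ∂γ

theorem isProbabilityMeasure_of_mem_couplings {μ μ' : Measure Z} [IsProbabilityMeasure μ]
    {γ : Measure (Z × Z)} (h : γ ∈ couplings μ μ') : IsProbabilityMeasure γ :=
  ⟨by rw [← Set.preimage_univ (f := Prod.fst), ← Measure.map_apply measurable_fst .univ, h.1,
    measure_univ]⟩

theorem prod_mem_couplings (μ μ' : Measure Z) [IsProbabilityMeasure μ] [IsProbabilityMeasure μ'] :
    μ.prod μ' ∈ couplings μ μ' := by
  refine ⟨?_, ?_⟩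
  · rw [Measure.map_fst_prod, measure_univ, one_smul]
  · rw [Measure.map_snd_prod, measure_univ, one_smul]

theorem transportCost_le (c : Z × Z → ℝ≥0∞) {μ μ' : Measure Z} {γ : Measure (Z × Z)}
    (h : γ ∈ couplings μ μ') : transportCost c μ μ' ≤ ∫⁻ p, c p ∂γ :=
  iInf₂_le γ h

theorem transportCost_le_of_bounded (c : Z × Z → ℝ≥0∞) {D : ℝ≥0∞} (hD : ∀ p, c p ≤ D)
    (μ μ' : Measure Z) [IsProbabilityMeasure μ] [IsProbabilityMeasure μ'] :
    transportCost c μ μ' ≤ D :=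
  (transportCost_le c (prod_mem_couplings μ μ')).trans ((lintegral_mono hD).trans (by simp))

/-- Lets one argue with an arbitrary coupling, so that no optimal one has to exist. -/
theorem le_mul_transportCost (c : Z × Z → ℝ≥0∞) (μ μ' : Measure Z) [IsProbabilityMeasure μ]
    [IsProbabilityMeasure μ'] {a K : ℝ≥0∞} (hK : K ≠ ∞)
    (h : ∀ γ ∈ couplings μ μ', a ≤ K * ∫⁻ p, c p ∂γ) : a ≤ K * transportCost c μ μ' := by
  have : Nonempty (couplings μ μ') := ⟨⟨_, prod_mem_couplings μ μ'⟩⟩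
  rw [transportCost, iInf_subtype', ENNReal.mul_iInf fun h' => absurd h' hK]
  exact le_iInf fun γ => h γ γ.2

/-- Gluing of two couplings along their common marginal. -/
theorem exists_coupling_le_add [StandardBorelSpace Z] {c : Z × Z → ℝ≥0∞} (hc : Measurable c)
    (htri : ∀ x y z, c (x, z) ≤ c (x, y) + c (y, z)) {μ₁ μ₂ μ₃ : Measure Z}
    [IsProbabilityMeasure μ₁] [IsProbabilityMeasure μ₂]
    {γ₁ γ₂ : Measure (Z × Z)} (h₁ : γ₁ ∈ couplings μ₁ μ₂)
    (h₂ : γ₂ ∈ couplings μ₂ μ₃) :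
    ∃ γ ∈ couplings μ₁ μ₃, ∫⁻ p, c p ∂γ ≤ ∫⁻ p, c p ∂γ₁ + ∫⁻ p, c p ∂γ₂ := by
  have : Nonempty Z := nonempty_of_isProbabilityMeasure μ₁
  have := isProbabilityMeasure_of_mem_couplings h₁
  have := isProbabilityMeasure_of_mem_couplings h₂
  -- Draw a pair from `γ₁`, then a third point from the conditional law of `γ₂` given the second
  -- point.
  set τ : Measure ((Z × Z) × Z) := 
    γ₁.compProd (γ₂.condKernel.comap Prod.snd measurable_snd)
  have hfst : τ.map Prod.fst = γ₁ := Measure.fst_compProd γ₁ _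
  have hm : Measurable fun p : (Z × Z) × Z => (p.1.2, p.2) := by fun_prop
  have hm' : Measurable fun p : (Z × Z) × Z => (p.1.1, p.2) := by fun_prop
  have hint : ∀ g : Z × Z → ℝ≥0∞, Measurable g →
      ∫⁻ p, g (p.1.2, p.2) ∂τ = ∫⁻ p, g p ∂γ₂ := by
    intro g hg
    have hgm : Measurable fun p : (Z × Z) × Z => g (p.1.2, p.2) := hg.comp hm
    rw [Measure.lintegral_compProd hgm]
    simp only [ProbabilityTheory.Kernel.comap_apply]
    -- The shared marginal `μ₂` is what makes the last two coordinates of `τ` have law `γ₂`.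
    have hmu : γ₂.fst = γ₁.map Prod.snd := h₂.1.trans h₁.2.symm
    conv_rhs => rw [← γ₂.disintegrate γ₂.condKernel, Measure.lintegral_compProd hg, hmu]
    rw [lintegral_map _ measurable_snd]
    exact hg.lintegral_kernel_prod_right'
  have hsnd : τ.map (fun p => (p.1.2, p.2)) = γ₂ := Measure.ext fun A hA => by
    have := hint (A.indicator 1) (measurable_one.indicator hA)
    rwa [lintegral_indicator_one hA,
      ← lintegral_map (f := A.indicator 1) (measurable_one.indicator hA) hm,
      lintegral_indicator_one hA] at this
  refine ⟨τ.map fun p => (p.1.1, p.2), ⟨?_, ?_⟩, ?_⟩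
  · rw [Measure.map_map measurable_fst hm', ← h₁.1, ← hfst,
      Measure.map_map measurable_fst measurable_fst]
    rfl
  · rw [Measure.map_map measurable_snd hm', ← h₂.2, ← hsnd, Measure.map_map measurable_snd hm]
    rfl
  · have hc1 : Measurable fun p : (Z × Z) × Z => c p.1 := hc.comp measurable_fst
    rw [lintegral_map hc hm', ← hint c hc, ← hfst, lintegral_map hc measurable_fst,
      ← lintegral_add_left hc1]
    exact lintegral_mono fun p => htri _ _ _

theorem transportCost_triangle [StandardBorelSpace Z] {c : Z × Z → ℝ≥0∞} (hc : Measurable c)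
    (htri : ∀ x y z, c (x, z) ≤ c (x, y) + c (y, z)) (μ₁ μ₂ μ₃ : Measure Z)
    [IsProbabilityMeasure μ₁] [IsProbabilityMeasure μ₂] :
    transportCost c μ₁ μ₃ ≤ transportCost c μ₁ μ₂ + transportCost c μ₂ μ₃ := by
  rw [transportCost, transportCost, transportCost, ENNReal.iInf_add]
  refine le_iInf fun γ₁ => ?_
  rw [ENNReal.iInf_add]
  refine le_iInf fun h₁ => ?_
  rw [ENNReal.add_iInf]
  refine le_iInf fun γ₂ => ?_
  rw [ENNReal.add_iInf]
  refine le_iInf fun h₂ => ?_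
  obtain ⟨γ, hγ, hle⟩ := exists_coupling_le_add hc htri h₁ h₂
  exact (iInf₂_le γ hγ).trans hle

/-- A sub-coupling of two probability measures extends to a coupling; the missing mass is
transported at a cost of at most `D`. -/
theorem exists_coupling_of_le {c : Z × Z → ℝ≥0∞} {D : ℝ≥0∞}
    (hD : ∀ p, c p ≤ D) {P Q : Measure Z} [IsProbabilityMeasure P] [IsProbabilityMeasure Q]
    {η : Measure (Z × Z)} (h₁ : η.map Prod.fst ≤ P) (h₂ : η.map Prod.snd ≤ Q) :
    ∃ γ ∈ couplings P Q, ∫⁻ p, c p ∂γ ≤ ∫⁻ p, c p ∂η + D * (1 - η Set.univ) := by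
  have e1 : η.map Prod.fst Set.univ = η Set.univ := by
    rw [Measure.map_apply measurable_fst .univ, Set.preimage_univ]
  have e2 : η.map Prod.snd Set.univ = η Set.univ := by
    rw [Measure.map_apply measurable_snd .univ, Set.preimage_univ]
  have f1 : IsFiniteMeasure (η.map Prod.fst) := isFiniteMeasure_of_le P h₁
  have f2 : IsFiniteMeasure (η.map Prod.snd) := isFiniteMeasure_of_le Q h₂
  set R := P - η.map Prod.fst
  set S := Q - η.map Prod.snd
  have hR : R + η.map Prod.fst = P := Measure.sub_add_cancel_of_le h₁
  have hS : S + η.map Prod.snd = Q := Measure.sub_add_cancel_of_le h₂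
  have mR : R Set.univ = 1 - η Set.univ := by
    rw [Measure.sub_apply .univ h₁, e1, measure_univ]
  have mS : S Set.univ = 1 - η Set.univ := by
    rw [Measure.sub_apply .univ h₂, e2, measure_univ]
  set r := 1 - η Set.univ
  have hrt : r ≠ ∞ := ENNReal.sub_ne_top ENNReal.one_ne_top
  have fR : IsFiniteMeasure R := ⟨mR ▸ hrt.lt_top⟩
  have fS : IsFiniteMeasure S := ⟨mS ▸ hrt.lt_top⟩
  rcases eq_or_ne r 0 with hr | hr
  · rw [hr, Measure.measure_univ_eq_zero] at mR mS
    exact ⟨η, ⟨by rw [← hR, mR, zero_add], by rw [← hS, mS, zero_add]⟩, by simp⟩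
  -- The leftovers `R` and `S` both have mass `r`, so `r⁻¹ • R.prod S` has them as marginals and has
  -- mass `r`.
  · refine ⟨η + r⁻¹ • R.prod S, ⟨?_, ?_⟩, ?_⟩
    · rw [Measure.map_add _ _ measurable_fst, Measure.map_smul, Measure.map_fst_prod, mS, smul_smul,
        ENNReal.inv_mul_cancel hr hrt, one_smul, add_comm, hR]
    · rw [Measure.map_add _ _ measurable_snd, Measure.map_smul, Measure.map_snd_prod, mR, smul_smul,
        ENNReal.inv_mul_cancel hr hrt, one_smul, add_comm, hS]
    · rw [lintegral_add_measure, lintegral_smul_measure]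
      refine add_le_add_right ?_ _
      calc r⁻¹ • ∫⁻ p, c p ∂(R.prod S) ≤ r⁻¹ * (D * (r * r)) := by
            refine mul_le_mul_right ((lintegral_mono hD).trans ?_) _
            rw [lintegral_const, ← Set.univ_prod_univ, Measure.prod_prod, mR, mS]
        _ = r⁻¹ * r * (D * r) := by ring
        _ = D * r := by rw [ENNReal.inv_mul_cancel hr hrt, one_mul]

variable {E : Type*} [MeasurableSpace E] {m : Measure E} {k : E × Z → ℝ≥0∞} {φ : E × Z → Z}

/-- If the kernel of an update moves unit mass at a cost of at most `A` times the initial cost,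
up to a mass of at most `B` times the initial cost, then the normalized update expands the
transport cost by at most `(A + D * B) / max Z Z'`. -/
theorem transportCost_normalize_pushUpdate_le [SFinite m] (hk : Measurable k) (hφ : Measurable φ)
    {c : Z × Z → ℝ≥0∞} (hc : Measurable c) (hsymm : ∀ x y, c (x, y) = c (y, x)) {D : ℝ≥0∞}
    (hD : ∀ p, c p ≤ D) (hDt : D ≠ ∞) {A B : ℝ≥0∞} (hA : A ≠ ∞) (hB : B ≠ ∞)
    (hkA : ∀ u v, ∫⁻ e, min (k (e, u)) (k (e, v)) * c (φ (e, u), φ (e, v)) ∂m ≤ A * c (u, v))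
    (hkB : ∀ u v, ∫⁻ e, k (e, u) ∂m ≤ ∫⁻ e, min (k (e, u)) (k (e, v)) ∂m + B * c (u, v))
    (μ μ' : Measure Z) [IsProbabilityMeasure μ] [IsProbabilityMeasure μ']
    {P P' : Measure Z} (hP : P = pushUpdate m k φ μ)
    (hP' : P' = pushUpdate m k φ μ') (h0 : P Set.univ ≠ 0) (h1 : P Set.univ ≠ ∞)
    (h0' : P' Set.univ ≠ 0) (h1' : P' Set.univ ≠ ∞) :
    transportCost c ((P Set.univ)⁻¹ • P) ((P' Set.univ)⁻¹ • P') ≤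
      (A + D * B) * (max (P Set.univ) (P' Set.univ))⁻¹ * transportCost c μ μ' := by
  have j1 := isProbabilityMeasure_normalize h0 h1
  have j2 := isProbabilityMeasure_normalize h0' h1'
  -- Scaling by the larger evidence keeps the common part below both normalized measures, and the
  -- resulting bound implies the one with either evidence.
  set M := max (P Set.univ) (P' Set.univ)
  have hM0 : M ≠ 0 := (h0.bot_lt.trans_le (le_max_left _ _)).ne'
  have hM1 : M ≠ ∞ := (max_lt h1.lt_top h1'.lt_top).ne
  refine le_mul_transportCost c μ μ' (ENNReal.mul_ne_top
    (ENNReal.add_ne_top.2 ⟨hA, ENNReal.mul_ne_top hDt hB⟩) (ENNReal.inv_ne_top.2 hM0))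
    fun γ hγ => ?_
  have := isProbabilityMeasure_of_mem_couplings hγ
  -- Both points of the pair use the same `e`; the minimum is the mass that both kernels can supply.
  set k₂ : E × (Z × Z) → ℝ≥0∞ := fun q => min (k (q.1, q.2.1)) (k (q.1, q.2.2))
  set φ₂ : E × (Z × Z) → Z × Z := fun q => (φ (q.1, q.2.1), φ (q.1, q.2.2))
  have hk₂ : Measurable k₂ := by fun_prop
  have hφ₂ : Measurable φ₂ := by fun_prop
  set η := pushUpdate m k₂ φ₂ γ
  have hmarg : ∀ (f : Z × Z → Z) (ρ R : Measure Z), Measurable f →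
      IsProbabilityMeasure ρ → γ.map f = ρ → R = pushUpdate m k φ ρ →
      (∀ e p, k₂ (e, p) ≤ k (e, f p)) → (∀ e p, f (φ₂ (e, p)) = φ (e, f p)) →
      η.map f ≤ R := by
    intro f ρ R hf hρ hγf hR hkf hφf
    refine Measure.le_iff.2 fun S hS => ?_
    rw [Measure.map_apply hf hS, pushUpdate_apply hk₂ hφ₂ γ (hf hS), hR,
      pushUpdate_apply hk hφ ρ hS, ← hγf, lintegral_map _ hf]
    · refine lintegral_mono fun p => lintegral_mono fun e => ?_
      refine mul_le_mul' (hkf e p) (le_of_eq ?_)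
      rw [← hφf]
      rfl
    · exact Measurable.lintegral_prod_left' (f := fun p : E × Z => k p * S.indicator 1 (φ p))
        (hk.mul ((measurable_one.indicator hS).comp hφ))
  have m1 : η.map Prod.fst ≤ P := hmarg Prod.fst μ P measurable_fst ‹_› hγ.1 hP
    (fun e p => min_le_left _ _) fun e p => rfl
  have m2 : η.map Prod.snd ≤ P' := hmarg Prod.snd μ' P' measurable_snd ‹_› hγ.2 hP'
    (fun e p => min_le_right _ _) fun e p => rfl
  have hcost : ∫⁻ p, c p ∂η ≤ A * ∫⁻ p, c p ∂γ := by
    rw [lintegral_pushUpdate hk₂ hφ₂ γ hc, ← lintegral_const_mul A hc]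
    exact lintegral_mono fun p => hkA p.1 p.2
  have hηu : η Set.univ = ∫⁻ p, ∫⁻ e, k₂ (e, p) ∂m ∂γ := pushUpdate_univ hk₂ hφ₂ γ
  have hku : Measurable fun u => ∫⁻ e, k (e, u) ∂m := Measurable.lintegral_prod_left' hk
  have hmass : M ≤ η Set.univ + B * ∫⁻ p, c p ∂γ := by
    rw [hηu, ← lintegral_const_mul B hc, ← lintegral_add_left
      (Measurable.lintegral_prod_left' hk₂)]
    refine max_le ?_ ?_
    · rw [hP, pushUpdate_univ hk hφ μ, ← hγ.1, lintegral_map hku measurable_fst]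
      exact lintegral_mono fun p => hkB p.1 p.2
    · rw [hP', pushUpdate_univ hk hφ μ', ← hγ.2, lintegral_map hku measurable_snd]
      refine lintegral_mono fun p => (hkB p.2 p.1).trans (le_of_eq ?_)
      rw [hsymm p.2 p.1]
      simp only [k₂, min_comm]
  have hle : ∀ R : Measure Z, R Set.univ ≤ M → M⁻¹ • R ≤ (R Set.univ)⁻¹ • R := fun R hR =>
    Measure.le_iff.2 fun S _ => mul_le_mul_left (ENNReal.inv_le_inv.2 hR) _
  have hsm : ∀ (f : Z × Z → Z) (R : Measure Z), η.map f ≤ R → R Set.univ ≤ M →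
      (M⁻¹ • η).map f ≤ (R Set.univ)⁻¹ • R := fun f R h hR => by
    rw [Measure.map_smul]
    exact le_trans (Measure.le_iff.2 fun S _ => mul_le_mul_right (h S) _) (hle R hR)
  obtain ⟨γ', hγ', hγc⟩ := exists_coupling_of_le hD (hsm Prod.fst P m1 (le_max_left _ _))
    (hsm Prod.snd P' m2 (le_max_right _ _))
  refine (transportCost_le c hγ').trans (hγc.trans ?_)
  rw [lintegral_smul_measure, Measure.smul_apply, smul_eq_mul, smul_eq_mul]
  -- The missing mass is measured against `M`, hence the need for `hmass` to bound both evidences.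
  have hrem : 1 - M⁻¹ * η Set.univ ≤ M⁻¹ * (B * ∫⁻ p, c p ∂γ) := by
    rw [tsub_le_iff_left, ← mul_add, ← ENNReal.inv_mul_cancel hM0 hM1]
    exact mul_le_mul_right hmass _
  calc _ ≤ M⁻¹ * (A * ∫⁻ p, c p ∂γ) + D * (M⁻¹ * (B * ∫⁻ p, c p ∂γ)) :=
        add_le_add (mul_le_mul_right hcost _) (mul_le_mul_right hrem _)
    _ = _ := by ring

end Transport

/-! ### Wasserstein distance and Lipschitz constants for a Polish metric -/

/-- The cost function of a metric. -/
noncomputable def metricCost {Z : Type*} (d : Z → Z → ℝ) (p : Z × Z) : ℝ≥0∞ := ENNReal.ofReal (d p.1 p.2)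

theorem metricCost_le_of_isLUB {Z : Type*} {d : Z → Z → ℝ} {D : ℝ}
    (hD : IsLUB (Set.range fun p : Z × Z => d p.1 p.2) D) (p : Z × Z) :
    metricCost d p ≤ ENNReal.ofReal D :=
  ENNReal.ofReal_le_ofReal (hD.1 ⟨p, rfl⟩)

section Wasserstein

variable {Z : Type*} [MeasurableSpace Z]

theorem wasserstein1_eq (d : Z → Z → ℝ) (μ μ' : Measure Z) :
    wasserstein1 d μ μ' = (transportCost (metricCost d) μ μ').toReal := rfl

theorem IsPolishMetric.standardBorelSpace {d : Z → Z → ℝ} (hd : IsPolishMetric d) :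
    StandardBorelSpace Z := by
  obtain ⟨_, -, _, _, _⟩ := hd
  have := UniformSpace.secondCountable_of_separable Z
  infer_instance

theorem IsPolishMetric.measurable_metricCost {d : Z → Z → ℝ} (hd : IsPolishMetric d) :
    Measurable (metricCost d) := by
  obtain ⟨_, hdd, _, _, _⟩ := hd
  have := UniformSpace.secondCountable_of_separable Z
  have : metricCost d = fun p => ENNReal.ofReal (dist p.1 p.2) := by
    ext p; rw [metricCost, hdd]
  rw [this]
  exact (measurable_fst.dist measurable_snd).ennreal_ofReal

theorem IsPolishMetric.nonneg {d : Z → Z → ℝ} (hd : IsPolishMetric d) (x y : Z) : 0 ≤ d x y := by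
  obtain ⟨_, hdd, -⟩ := hd
  exact hdd x y ▸ dist_nonneg

theorem IsPolishMetric.self {d : Z → Z → ℝ} (hd : IsPolishMetric d) (x : Z) : d x x = 0 := by
  obtain ⟨_, hdd, -⟩ := hd
  rw [← hdd, dist_self]

theorem IsPolishMetric.pos {d : Z → Z → ℝ} (hd : IsPolishMetric d) {x y : Z} (h : x ≠ y) :
    0 < d x y := by
  obtain ⟨_, hdd, -⟩ := hd
  exact hdd x y ▸ dist_pos.2 h

theorem IsPolishMetric.comm {d : Z → Z → ℝ} (hd : IsPolishMetric d) (x y : Z) :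
    d x y = d y x := by
  obtain ⟨_, hdd, -⟩ := hd
  rw [← hdd, ← hdd, dist_comm]

theorem IsPolishMetric.metricCost_comm {d : Z → Z → ℝ} (hd : IsPolishMetric d) (x y : Z) :
    metricCost d (x, y) = metricCost d (y, x) := by
  rw [metricCost, metricCost, hd.comm]

theorem IsPolishMetric.metricCost_triangle {d : Z → Z → ℝ} (hd : IsPolishMetric d) (x y z : Z) :
    metricCost d (x, z) ≤ metricCost d (x, y) + metricCost d (y, z) := by
  rw [metricCost, metricCost, metricCost, ← ENNReal.ofReal_add (hd.nonneg _ _) (hd.nonneg _ _)]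
  refine ENNReal.ofReal_le_ofReal ?_
  obtain ⟨_, hdd, -⟩ := hd
  simp only [← hdd]
  exact dist_triangle _ _ _

/-- Boundedness of `d` keeps all costs finite; otherwise `toReal` could send an infinite cost to 0.
-/
theorem wasserstein1_triangle {d : Z → Z → ℝ} (hd : IsPolishMetric d) {D : ℝ}
    (hD : IsLUB (Set.range fun p : Z × Z => d p.1 p.2) D) (μ₁ μ₂ μ₃ : Measure Z)
    [IsProbabilityMeasure μ₁] [IsProbabilityMeasure μ₂] [IsProbabilityMeasure μ₃] :
    wasserstein1 d μ₁ μ₃ ≤ wasserstein1 d μ₁ μ₂ + wasserstein1 d μ₂ μ₃ := by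
  have := hd.standardBorelSpace
  have fin : ∀ (ρ ρ' : Measure Z) [IsProbabilityMeasure ρ] [IsProbabilityMeasure ρ'],
      transportCost (metricCost d) ρ ρ' ≠ ∞ := fun ρ ρ' _ _ =>
    ((transportCost_le_of_bounded _ (metricCost_le_of_isLUB hD) ρ ρ').trans_lt
      ENNReal.ofReal_lt_top).ne
  simp only [wasserstein1_eq]
  rw [← ENNReal.toReal_add (fin _ _) (fin _ _)]
  exact ENNReal.toReal_mono (ENNReal.add_ne_top.2 ⟨fin _ _, fin _ _⟩)
    (transportCost_triangle hd.measurable_metricCost hd.metricCost_triangle _ _ _)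

/-- The defining property of the best Lipschitz constant, without subtraction. -/
theorem ofReal_le_add_lipConst_mul {d : Z → Z → ℝ} (hd : IsPolishMetric d) (f : Z → ℝ≥0)
    (x x' : Z) :
    (f x : ℝ≥0∞) ≤ f x' + lipConst d (fun z => (f z : ℝ)) * metricCost d (x, x') := by
  rcases eq_or_ne x x' with rfl | h
  · exact le_self_add
  have h1 : ENNReal.ofReal (|(f x : ℝ) - f x'| / d x x') ≤ lipConst d fun z => (f z : ℝ) :=
    le_iSup_of_le x (le_iSup_of_le x' (le_iSup_of_le h le_rfl))
  have hp := hd.pos h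
  refine le_trans ?_ (add_le_add_right (mul_le_mul_left h1 _) _)
  rw [metricCost, ← ENNReal.ofReal_mul (by positivity), div_mul_cancel₀ _ hp.ne',
    ← ENNReal.ofReal_coe_nnreal, ← ENNReal.ofReal_coe_nnreal,
    ← ENNReal.ofReal_add (NNReal.coe_nonneg _) (abs_nonneg _)]
  refine ENNReal.ofReal_le_ofReal ?_
  linarith [le_abs_self ((f x : ℝ) - f x')]

end Wasserstein

/-! ### Joint densities as iterated integrals -/

section PathWeight

variable {X W : Type*} [MeasurableSpace X] [MeasurableSpace W]

/-- The total weight of the paths of length `n` starting from `x0` at time `s`, when the step at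
time `i` from `x'` to `x` has weight `g i x x'`. -/
noncomputable def pathWeight (ν : Measure X) (g : ℕ → X → X → ℝ≥0∞) : ℕ → ℕ → X → ℝ≥0∞
  | _, 0, _ => 1
  | s, n + 1, x0 => ∫⁻ x, g (s + 1) x x0 * pathWeight ν g (s + 1) n x ∂ν

/-- The extra variable `w` is the parameter in PS; for SE it is taken in `Unit`. -/
theorem measurable_pathWeight (ν : Measure X) [SFinite ν] {g : ℕ → X → X → W → ℝ≥0∞}
    (hg : ∀ i, Measurable fun p : X × X × W => g i p.1 p.2.1 p.2.2) (n s : ℕ) :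
    Measurable fun p : X × W => pathWeight ν (fun i x x' => g i x x' p.2) s n p.1 := by
  induction n generalizing s with
  | zero => exact measurable_const
  | succ n ih =>
    simp only [pathWeight]
    refine Measurable.lintegral_prod_left' (f := fun q : X × X × W =>
      g (s + 1) q.1 q.2.1 q.2.2 * pathWeight ν (fun i x x' => g i x x' q.2.2) (s + 1) n q.1) ?_
    exact (hg _).mul ((ih (s + 1)).comp (measurable_fst.prodMk (measurable_snd.comp measurable_snd)))

theorem lintegral_pi_prod_eq_pathWeight (ν : Measure X) [SigmaFinite ν] {g : ℕ → X → X → ℝ≥0∞}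
    (hg : ∀ i, Measurable fun p : X × X => g i p.1 p.2) (n s : ℕ) (x0 : X) :
    ∫⁻ x : Fin n → X, ∏ i : Fin n,
      g (s + i + 1) (x i) (Fin.cons (α := fun _ => X) x0 x i.castSucc) ∂(Measure.pi fun _ => ν) =
      pathWeight ν g s n x0 := by
  have hmeas : ∀ (n s : ℕ) (x0 : X), Measurable fun x : Fin n → X => ∏ i : Fin n,
      g (s + i + 1) (x i) (Fin.cons (α := fun _ => X) x0 x i.castSucc) := by
    intro n s x0
    refine Finset.measurable_prod _ fun i _ => ?_
    have hcons : Measurable fun x : Fin n → X =>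
        (Fin.cons (α := fun _ => X) x0 x i.castSucc : X) := by
      rcases Fin.eq_zero_or_eq_succ (i.castSucc) with h | ⟨j, h⟩
      · simp only [h, Fin.cons_zero]; exact measurable_const
      · simp only [h, Fin.cons_succ]; exact measurable_pi_apply j
    exact (hg (s + i + 1)).comp ((measurable_pi_apply i).prodMk hcons)
  induction n generalizing s x0 with
  | zero => simp [pathWeight]
  | succ n ih =>
    -- Splitting off coordinate 0 isolates the first step of the path; the rest is a path from that
    -- state, one time later.
    have hp := (measurePreserving_piFinSuccAbove (fun _ : Fin (n + 1) => ν) 0).symm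
    have hm : Measurable fun q => ∏ i : Fin (n + 1), g (s + i + 1)
        ((MeasurableEquiv.piFinSuccAbove (fun _ => X) 0).symm q i) (Fin.cons (α := fun _ => X) x0
          ((MeasurableEquiv.piFinSuccAbove (fun _ => X) 0).symm q) i.castSucc) :=
      (hmeas (n + 1) s x0).comp hp.measurable
    rw [← hp.lintegral_comp (hmeas (n + 1) s x0), lintegral_prod _ hm.aemeasurable, pathWeight]
    refine lintegral_congr fun a => ?_
    rw [← ih (s + 1) a, ← lintegral_const_mul _ (hmeas n (s + 1) a)]
    refine lintegral_congr fun x => ?_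
    simp only [MeasurableEquiv.piFinSuccAbove_symm_apply, Fin.insertNthEquiv, Equiv.coe_fn_mk,
      Fin.insertNth_zero, Fin.prod_univ_succ, Fin.castSucc_zero, Fin.cons_zero, Fin.val_zero,
      add_zero, Fin.cons_succ, Fin.val_succ, ← Fin.succ_castSucc]
    congr 1
    refine Finset.prod_congr rfl fun i _ => ?_
    rw [show s + (↑i + 1) + 1 = s + 1 + ↑i + 1 by ring]
    rfl

end PathWeight

/-! ### The joint density as a product of evidences -/

section Evidence

variable {Z : Type*} [MeasurableSpace Z]

theorem eq_evidence_smul_posterior {Ft : Measure Z → Measure Z} {μ : Measure Z}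
    (h0 : evidence Ft μ ≠ 0) (h1 : evidence Ft μ ≠ ∞) :
    Ft μ = evidence Ft μ • posterior Ft μ := by
  rw [posterior, smul_smul, ENNReal.mul_inv_cancel h0 h1, one_smul]

theorem isProbabilityMeasure_truePosterior {Ft : ℕ → Measure Z → Measure Z} {P0 : Measure Z}
    [IsProbabilityMeasure P0] {k : ℕ}
    (h0 : ∀ i < k, evidence (Ft (i + 1)) (truePosterior Ft P0 i) ≠ 0)
    (h1 : ∀ i < k, evidence (Ft (i + 1)) (truePosterior Ft P0 i) ≠ ∞) {n : ℕ} (hn : n ≤ k) :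
    IsProbabilityMeasure (truePosterior Ft P0 n) := by
  cases n with
  | zero => assumption
  | succ n => exact isProbabilityMeasure_posterior (h0 n hn) (h1 n hn)

/-- The joint density of the data is the product of the evidences. Here `J s n z` is the joint
density of the data at times `s + 1, …, s + n` given that the unknown is `z` at time `s`. -/
theorem lintegral_eq_prod_evidence {Ft : ℕ → Measure Z → Measure Z} {P0 : Measure Z}
    [IsProbabilityMeasure P0] {k : ℕ}
    (h0 : ∀ i < k, evidence (Ft (i + 1)) (truePosterior Ft P0 i) ≠ 0)
    (h1 : ∀ i < k, evidence (Ft (i + 1)) (truePosterior Ft P0 i) ≠ ∞)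
    (J : ℕ → ℕ → Z → ℝ≥0∞) (hJ0 : ∀ s z, J s 0 z = 1)
    (hJ : ∀ i < k, ∀ n, ∫⁻ z, J i (n + 1) z ∂(truePosterior Ft P0 i) =
      ∫⁻ z, J (i + 1) n z ∂(Ft (i + 1) (truePosterior Ft P0 i))) {n : ℕ} (hn : n ≤ k) :
    ∫⁻ z, J 0 n z ∂P0 =
      ∏ i ∈ Finset.Icc 1 n, evidence (Ft i) (truePosterior Ft P0 (i - 1)) := by
  -- After assimilating `m` data points, their evidences have come out as factors and the remaining
  -- density is integrated against the `m`-th posterior.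
  have key : ∀ m ≤ n, ∫⁻ z, J 0 n z ∂P0 =
      (∏ i ∈ Finset.Icc 1 m, evidence (Ft i) (truePosterior Ft P0 (i - 1))) *
        ∫⁻ z, J m (n - m) z ∂(truePosterior Ft P0 m) := by
    intro m hm
    induction m with
    | zero => simp [truePosterior]
    | succ m ih =>
      rw [ih (by omega), Finset.prod_Icc_succ_top (by omega), mul_assoc, Nat.add_sub_cancel,
        show n - m = n - (m + 1) + 1 by omega, hJ m (by omega),
        eq_evidence_smul_posterior (h0 m (by omega)) (h1 m (by omega)), lintegral_smul_measure]
      rfl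
  have := isProbabilityMeasure_truePosterior h0 h1 hn
  rw [key n le_rfl, Nat.sub_self]
  simp [hJ0]

theorem predictive_eq_prod {e p : ℕ → ℝ≥0∞} {k : ℕ} (h0 : ∀ i ∈ Finset.Icc 1 k, e i ≠ 0)
    (h1 : ∀ i ∈ Finset.Icc 1 k, e i ≠ ∞) (hp : ∀ n ≤ k, p n = ∏ i ∈ Finset.Icc 1 n, e i) {j : ℕ}
    (hj : j ≤ k) : predictive p j k = ∏ i ∈ Finset.Icc (j + 1) k, (e i).toReal := by
  have hsplit : ∏ i ∈ Finset.Icc 1 k, e i =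
      (∏ i ∈ Finset.Icc 1 j, e i) * ∏ i ∈ Finset.Icc (j + 1) k, e i := by
    rw [← Finset.prod_union (Finset.disjoint_left.2 fun a ha hb => by
      simp only [Finset.mem_Icc] at ha hb; omega)]
    congr 1
    ext a
    simp only [Finset.mem_union, Finset.mem_Icc]
    omega
  have hsub : ∀ i ∈ Finset.Icc 1 j, i ∈ Finset.Icc 1 k := fun i hi => by
    simp only [Finset.mem_Icc] at hi ⊢; omega
  rw [predictive, hp k le_rfl, hp j hj, hsplit, mul_comm, ENNReal.mul_div_cancel_right
    (Finset.prod_ne_zero_iff.2 fun i hi => h0 i (hsub i hi))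
    (ENNReal.prod_ne_top fun i hi => h1 i (hsub i hi)), ENNReal.toReal_prod]

end Evidence

/-! ### Error bounds for sequences of push updates -/

/-- A sequence of updates which act on the true and on the approximate posteriors as push updates
with kernels `κ i`, and for which `p n` is the product of the first `n` evidences. -/
structure IsPushFilter {E Z : Type*} [MeasurableSpace E] [MeasurableSpace Z] (m : Measure E)
    (κ : ℕ → E × Z → ℝ≥0∞) (φ : E × Z → Z) (Ft : ℕ → Measure Z → Measure Z) (P0 : Measure Z)
    (Q : ℕ → Measure Z) (p : ℕ → ℝ≥0∞) (k : ℕ) : Prop where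
  sFinite : SFinite m
  measurable_kernel : ∀ i, Measurable (κ i)
  measurable_map : Measurable φ
  prob_init : IsProbabilityMeasure P0
  prob_approx : ∀ i, IsProbabilityMeasure (Q i)
  approx_zero : Q 0 = P0
  true_eq : ∀ i < k, Ft (i + 1) (truePosterior Ft P0 i) =
    pushUpdate m (κ (i + 1)) φ (truePosterior Ft P0 i)
  true_ne_zero : ∀ i < k, evidence (Ft (i + 1)) (truePosterior Ft P0 i) ≠ 0
  true_ne_top : ∀ i < k, evidence (Ft (i + 1)) (truePosterior Ft P0 i) ≠ ∞
  approx_eq : ∀ i < k, Ft (i + 1) (Q i) = pushUpdate m (κ (i + 1)) φ (Q i)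
  approx_ne_zero : ∀ i < k, evidence (Ft (i + 1)) (Q i) ≠ 0
  approx_ne_top : ∀ i < k, evidence (Ft (i + 1)) (Q i) ≠ ∞
  density_eq : ∀ n ≤ k, p n =
    ∏ i ∈ Finset.Icc 1 n, evidence (Ft i) (truePosterior Ft P0 (i - 1))

theorem errorBound_congr {Z : Type*} [MeasurableSpace Z] {d : Measure Z → Measure Z → ℝ}
    {c c' : ℕ → ℝ} {Ft : ℕ → Measure Z → Measure Z} {Q : ℕ → Measure Z} {k : ℕ}
    (h : ∀ j ≤ k, c j = c' j) : errorBound d c Ft Q k = errorBound d c' Ft Q k := by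
  rw [errorBound, errorBound]
  congr 1
  refine Finset.sum_congr rfl fun j hj => ?_
  rw [h j]
  simp only [Finset.mem_Icc] at hj
  omega

theorem prod_const_mul_Icc (r : ℝ) (f : ℕ → ℝ) (j k : ℕ) :
    ∏ i ∈ Finset.Icc (j + 1) k, r * f i = r ^ (k - j) * ∏ i ∈ Finset.Icc (j + 1) k, f i := by
  rw [Finset.prod_mul_distrib, Finset.prod_const, Nat.card_Icc]
  congr 2
  omega

namespace IsPushFilter

variable {E Z : Type*} [MeasurableSpace E] [MeasurableSpace Z] {m : Measure E}
  {κ : ℕ → E × Z → ℝ≥0∞} {φ : E × Z → Z} {Ft : ℕ → Measure Z → Measure Z} {P0 : Measure Z}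
  {Q : ℕ → Measure Z} {p : ℕ → ℝ≥0∞} {k : ℕ}

theorem prob_true (H : IsPushFilter m κ φ Ft P0 Q p k) {i : ℕ} (hi : i ≤ k) :
    IsProbabilityMeasure (truePosterior Ft P0 i) :=
  haveI := H.prob_init
  isProbabilityMeasure_truePosterior H.true_ne_zero H.true_ne_top hi

theorem prob_exactUpdate (H : IsPushFilter m κ φ Ft P0 Q p k) {i : ℕ} (h1 : 1 ≤ i) (hi : i ≤ k) :
    IsProbabilityMeasure (exactUpdate Ft Q i) := by
  obtain ⟨i, rfl⟩ : ∃ l, i = l + 1 := ⟨i - 1, by omega⟩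
  exact isProbabilityMeasure_posterior (H.approx_ne_zero i hi) (H.approx_ne_top i hi)

theorem predictive_eq (H : IsPushFilter m κ φ Ft P0 Q p k) {j : ℕ} (hj : j ≤ k) :
    predictive p j k = ∏ i ∈ Finset.Icc (j + 1) k,
      (evidence (Ft i) (truePosterior Ft P0 (i - 1))).toReal := by
  have aux : ∀ i ∈ Finset.Icc 1 k, i - 1 < k ∧ i - 1 + 1 = i := fun i hi => by
    simp only [Finset.mem_Icc] at hi; omega
  refine predictive_eq_prod (fun i hi => ?_) (fun i hi => ?_) H.density_eq hj
  · have := H.true_ne_zero (i - 1) (aux i hi).1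
    rwa [(aux i hi).2] at this
  · have := H.true_ne_top (i - 1) (aux i hi).1
    rwa [(aux i hi).2] at this

theorem dist_le (H : IsPushFilter m κ φ Ft P0 Q p k) (hk : 1 ≤ k)
    {d : Measure Z → Measure Z → ℝ}
    (htri : ∀ μ₁ μ₂ μ₃ : Measure Z, IsProbabilityMeasure μ₁ → IsProbabilityMeasure μ₂ →
      IsProbabilityMeasure μ₃ → d μ₁ μ₃ ≤ d μ₁ μ₂ + d μ₂ μ₃)
    {a : ℕ → ℝ} (ha : ∀ i, 0 ≤ a i)
    (hstep : ∀ i < k, d (truePosterior Ft P0 (i + 1)) (exactUpdate Ft Q (i + 1)) ≤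
      a (i + 1) * d (truePosterior Ft P0 i) (Q i)) :
    d (truePosterior Ft P0 k) (Q k) ≤
      errorBound d (fun j => ∏ i ∈ Finset.Icc (j + 1) k, a i) Ft Q k := by
  refine dist_truePosterior_le d Ft P0 Q H.approx_zero a k hk (fun i hi => ?_) ha fun i hi => ?_
  · simp only [Finset.mem_Icc] at hi
    exact htri _ _ _ (H.prob_true hi.2) (H.prob_exactUpdate hi.1 hi.2) (H.prob_approx i)
  · simp only [Finset.mem_Icc] at hi
    have := hstep (i - 1) (by omega)
    rwa [show i - 1 + 1 = i by omega] at this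

/-- Error bounds for a distance such that the `i`-th update expands by the factor `c i / Z` at most,
where `Z` is the evidence of either prior. -/
theorem dist_le_div_evidence (H : IsPushFilter m κ φ Ft P0 Q p k) (hk : 1 ≤ k)
    {d : Measure Z → Measure Z → ℝ}
    (htri : ∀ μ₁ μ₂ μ₃ : Measure Z, IsProbabilityMeasure μ₁ → IsProbabilityMeasure μ₂ →
      IsProbabilityMeasure μ₃ → d μ₁ μ₃ ≤ d μ₁ μ₂ + d μ₂ μ₃)
    {c : ℕ → ℝ} (hc : ∀ i, 0 ≤ c i)
    (hstep : ∀ i < k,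
      d (truePosterior Ft P0 (i + 1)) (exactUpdate Ft Q (i + 1)) ≤
        c (i + 1) / (evidence (Ft (i + 1)) (truePosterior Ft P0 i)).toReal *
          d (truePosterior Ft P0 i) (Q i) ∧
      d (truePosterior Ft P0 (i + 1)) (exactUpdate Ft Q (i + 1)) ≤
        c (i + 1) / (evidence (Ft (i + 1)) (Q i)).toReal * d (truePosterior Ft P0 i) (Q i)) :
    d (truePosterior Ft P0 k) (Q k) ≤ errorBound d (fun j =>
        (∏ i ∈ Finset.Icc (j + 1) k, c i) / predictive p j k) Ft Q k ∧
      d (truePosterior Ft P0 k) (Q k) ≤ errorBound d (fun j => ∏ i ∈ Finset.Icc (j + 1) k,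
        c i / (evidence (Ft i) (Q (i - 1))).toReal) Ft Q k := by
  refine ⟨?_, ?_⟩
  · refine (H.dist_le hk htri (a := fun i =>
      c i / (evidence (Ft i) (truePosterior Ft P0 (i - 1))).toReal)
      (fun i => div_nonneg (hc i) ENNReal.toReal_nonneg) fun i hi => (hstep i hi).1).trans_eq
      (errorBound_congr fun j hj => ?_)
    rw [H.predictive_eq hj, Finset.prod_div_distrib]
  · exact H.dist_le hk htri (a := fun i => c i / (evidence (Ft i) (Q (i - 1))).toReal)
      (fun i => div_nonneg (hc i) ENNReal.toReal_nonneg) fun i hi => (hstep i hi).2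

theorem tvDist_le (H : IsPushFilter m κ φ Ft P0 Q p k) (hk : 1 ≤ k) {C : ℕ → ℝ≥0∞}
    (hC : ∀ i ∈ Finset.Icc 1 k, C i < ∞) (hκC : ∀ i u, ∫⁻ e, κ i (e, u) ∂m ≤ C i) :
    tvDist (truePosterior Ft P0 k) (Q k) ≤ errorBound tvDist (fun j =>
        (∏ i ∈ Finset.Icc (j + 1) k, (C i).toReal) / predictive p j k) Ft Q k ∧
      tvDist (truePosterior Ft P0 k) (Q k) ≤ errorBound tvDist (fun j =>
        ∏ i ∈ Finset.Icc (j + 1) k, (C i).toReal / (evidence (Ft i) (Q (i - 1))).toReal) Ft Q k := by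
  have := H.sFinite
  refine H.dist_le_div_evidence hk (fun μ₁ μ₂ μ₃ _ _ _ => tvDist_triangle μ₁ μ₂ μ₃)
    (fun i => ENNReal.toReal_nonneg) fun i hi => ?_
  have := H.prob_true hi.le
  have := H.prob_approx i
  have hCi := (hC (i + 1) (Finset.mem_Icc.2 ⟨by omega, hi⟩)).ne
  have hκ := H.measurable_kernel (i + 1)
  refine ⟨tvDist_normalize_pushUpdate_le hκ H.measurable_map _ _ hCi (hκC _) (H.true_eq i hi)
    (H.approx_eq i hi) (H.true_ne_zero i hi) (H.approx_ne_zero i hi), ?_⟩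
  -- The one-step estimate features the evidence of its first prior, so symmetry gives the version
  -- with `Q i`.
  rw [tvDist_comm, tvDist_comm (truePosterior Ft P0 i)]
  exact tvDist_normalize_pushUpdate_le hκ H.measurable_map _ _ hCi (hκC _) (H.approx_eq i hi)
    (H.true_eq i hi) (H.approx_ne_zero i hi) (H.true_ne_zero i hi)

theorem hellingerDist_le (H : IsPushFilter m κ φ Ft P0 Q p k) (hk : 1 ≤ k) {C : ℕ → ℝ≥0∞}
    (hC : ∀ i ∈ Finset.Icc 1 k, C i < ∞) (hκC : ∀ i u, ∫⁻ e, κ i (e, u) ∂m ≤ C i) :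
    hellingerDist (truePosterior Ft P0 k) (Q k) ≤ errorBound hellingerDist (fun j =>
        2 ^ (k - j) * (∏ i ∈ Finset.Icc (j + 1) k, √(C i).toReal) / √(predictive p j k)) Ft Q k ∧
      hellingerDist (truePosterior Ft P0 k) (Q k) ≤ errorBound hellingerDist (fun j =>
        2 ^ (k - j) * ∏ i ∈ Finset.Icc (j + 1) k,
          √(C i).toReal / √(evidence (Ft i) (Q (i - 1))).toReal) Ft Q k := by
  have := H.sFinite
  have htri : ∀ μ₁ μ₂ μ₃ : Measure Z, IsProbabilityMeasure μ₁ → IsProbabilityMeasure μ₂ →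
      IsProbabilityMeasure μ₃ → hellingerDist μ₁ μ₃ ≤ hellingerDist μ₁ μ₂ + hellingerDist μ₂ μ₃ :=
    fun μ₁ μ₂ μ₃ _ _ _ => hellingerDist_triangle μ₁ μ₂ μ₃
  have hCi : ∀ i < k, C (i + 1) ≠ ∞ := fun i hi =>
    (hC (i + 1) (Finset.mem_Icc.2 ⟨by omega, hi⟩)).ne
  refine ⟨?_, ?_⟩
  · refine (H.dist_le hk htri (a := fun i => 2 * √(C i).toReal /
      √(evidence (Ft i) (truePosterior Ft P0 (i - 1))).toReal) (fun i => by positivity)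
      fun i hi => ?_).trans_eq (errorBound_congr fun j hj => ?_)
    · have := H.prob_true hi.le
      have := H.prob_approx i
      exact hellingerDist_normalize_pushUpdate_le (H.measurable_kernel (i + 1)) H.measurable_map _ _
        (hCi i hi) (hκC _) (H.true_eq i hi) (H.approx_eq i hi) (H.true_ne_zero i hi)
        (H.approx_ne_zero i hi)
    -- Each of the `k - j` steps contributes one factor 2, collected into the power.
    · rw [H.predictive_eq hj, Real.sqrt_prod _ fun _ _ => ENNReal.toReal_nonneg,
        Finset.prod_div_distrib, prod_const_mul_Icc]
  · refine (H.dist_le hk htri (a := fun i => 2 * √(C i).toReal /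
      √(evidence (Ft i) (Q (i - 1))).toReal) (fun i => by positivity)
      fun i hi => ?_).trans_eq (errorBound_congr fun j hj => ?_)
    · have := H.prob_true hi.le
      have := H.prob_approx i
      rw [hellingerDist_comm, hellingerDist_comm (truePosterior Ft P0 i)]
      exact hellingerDist_normalize_pushUpdate_le (H.measurable_kernel (i + 1)) H.measurable_map _ _
        (hCi i hi) (hκC _) (H.approx_eq i hi) (H.true_eq i hi) (H.approx_ne_zero i hi)
        (H.true_ne_zero i hi)
    · simp only [mul_div_assoc]
      rw [prod_const_mul_Icc]

/-- `L i e` is a Lipschitz constant of `κ i (e, ·)`, and `A i` bounds the cost of moving the common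
part of the mass, relative to the initial cost. -/
theorem wasserstein1_le (H : IsPushFilter m κ φ Ft P0 Q p k) (hk : 1 ≤ k) {d : Z → Z → ℝ}
    (hd : IsPolishMetric d) {D : ℝ} (hD : IsLUB (Set.range fun p : Z × Z => d p.1 p.2) D)
    {A : ℕ → ℝ≥0∞} {L : ℕ → E → ℝ≥0∞} (hA : ∀ i ∈ Finset.Icc 1 k, A i < ∞)
    (hL : ∀ i ∈ Finset.Icc 1 k, ∫⁻ e, L i e ∂m < ∞)
    (hκA : ∀ i u v, ∫⁻ e, min (κ i (e, u)) (κ i (e, v)) * metricCost d (φ (e, u), φ (e, v)) ∂m ≤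
      A i * metricCost d (u, v))
    (hκL : ∀ i e u v, κ i (e, u) ≤ κ i (e, v) + L i e * metricCost d (u, v)) :
    wasserstein1 d (truePosterior Ft P0 k) (Q k) ≤ errorBound (wasserstein1 d) (fun j =>
        (∏ i ∈ Finset.Icc (j + 1) k, (2 * D * (∫⁻ e, L i e ∂m).toReal + (A i).toReal)) /
          predictive p j k) Ft Q k ∧
      wasserstein1 d (truePosterior Ft P0 k) (Q k) ≤ errorBound (wasserstein1 d) (fun j =>
        ∏ i ∈ Finset.Icc (j + 1) k, (2 * D * (∫⁻ e, L i e ∂m).toReal + (A i).toReal) /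
          (evidence (Ft i) (Q (i - 1))).toReal) Ft Q k := by
  have := H.sFinite
  have hD0 : 0 ≤ D := by
    have := H.prob_init
    obtain ⟨z⟩ := nonempty_of_isProbabilityMeasure P0
    exact (hd.nonneg z z).trans (hD.1 ⟨(z, z), rfl⟩)
  refine H.dist_le_div_evidence hk (fun μ₁ μ₂ μ₃ _ _ _ => wasserstein1_triangle hd hD μ₁ μ₂ μ₃)
    (fun i => by positivity) fun i hi => ?_
  have := H.prob_true hi.le
  have := H.prob_approx i
  have hi' : i + 1 ∈ Finset.Icc 1 k := Finset.mem_Icc.2 ⟨by omega, hi⟩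
  have hκ := H.measurable_kernel (i + 1)
  have hAt := (hA _ hi').ne
  have hLt := (hL _ hi').ne
  set B := ∫⁻ e, L (i + 1) e ∂m
  have hκB : ∀ u v, ∫⁻ e, κ (i + 1) (e, u) ∂m ≤
      ∫⁻ e, min (κ (i + 1) (e, u)) (κ (i + 1) (e, v)) ∂m + B * metricCost d (u, v) := by
    intro u v
    simp only [B]
    -- A best Lipschitz constant need not be measurable in `e`; these two identities do not require
    -- it.
    rw [← lintegral_mul_const' (metricCost d (u, v)) _ ENNReal.ofReal_ne_top, ← lintegral_add_left (by fun_prop)]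
    refine lintegral_mono fun e => ?_
    rw [min_add]
    exact le_min le_self_add (hκL _ e u v)
  have key := transportCost_normalize_pushUpdate_le hκ H.measurable_map hd.measurable_metricCost
    hd.metricCost_comm (metricCost_le_of_isLUB hD) ENNReal.ofReal_ne_top hAt hLt (hκA (i + 1)) hκB
    (truePosterior Ft P0 i) (Q i) (H.true_eq i hi) (H.approx_eq i hi) (H.true_ne_zero i hi)
    (H.true_ne_top i hi) (H.approx_ne_zero i hi) (H.approx_ne_top i hi)
  set T := transportCost (metricCost d) (truePosterior Ft P0 i) (Q i)
  have hT : T ≠ ∞ := ((transportCost_le_of_bounded _ (metricCost_le_of_isLUB hD) _ _).trans_lt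
    ENNReal.ofReal_lt_top).ne
  have hDB : A (i + 1) + ENNReal.ofReal D * B ≠ ∞ :=
    ENNReal.add_ne_top.2 ⟨hAt, ENNReal.mul_ne_top ENNReal.ofReal_ne_top hLt⟩
  -- `z` stands for either of the two evidences.
  have fin : ∀ z : ℝ≥0∞, z ≠ 0 → z ≤ max (Ft (i + 1) (truePosterior Ft P0 i) Set.univ)
      (Ft (i + 1) (Q i) Set.univ) →
      wasserstein1 d (truePosterior Ft P0 (i + 1)) (exactUpdate Ft Q (i + 1)) ≤
        (2 * D * B.toReal + (A (i + 1)).toReal) / z.toReal *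
          wasserstein1 d (truePosterior Ft P0 i) (Q i) := by
    intro z hz0 hz
    have h1 : transportCost (metricCost d) (truePosterior Ft P0 (i + 1))
        (exactUpdate Ft Q (i + 1)) ≤ (A (i + 1) + ENNReal.ofReal D * B) * z⁻¹ * T :=
      key.trans (mul_le_mul_left (mul_le_mul_right (ENNReal.inv_le_inv.2 hz) _) _)
    have h2 := ENNReal.toReal_mono (ENNReal.mul_ne_top (ENNReal.mul_ne_top hDB
      (ENNReal.inv_ne_top.2 hz0)) hT) h1
    rw [ENNReal.toReal_mul, ENNReal.toReal_mul, ENNReal.toReal_inv, ENNReal.toReal_add hAt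
      (ENNReal.mul_ne_top ENNReal.ofReal_ne_top hLt), ENNReal.toReal_mul,
      ENNReal.toReal_ofReal hD0, ← div_eq_mul_inv] at h2
    refine h2.trans (mul_le_mul_of_nonneg_right (div_le_div_of_nonneg_right ?_
      ENNReal.toReal_nonneg) ENNReal.toReal_nonneg)
    -- The transport estimate yields `D * B`; the claimed `2 * D * B` is larger.
    have : 0 ≤ D * B.toReal := by positivity
    linarith
  exact ⟨fin _ (H.true_ne_zero i hi) (le_max_left _ _),
    fin _ (H.approx_ne_zero i hi) (le_max_right _ _)⟩

end IsPushFilter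

/-- The common part of two kernels costs no more to move than the initial displacement, when the
map does not increase the cost. -/
theorem lintegral_min_mul_cost_le {E Z : Type*} [MeasurableSpace E] {m : Measure E}
    {κ : E × Z → ℝ≥0∞} {φ : E × Z → Z} {d : Z → Z → ℝ}
    (hφ : ∀ e u v, d (φ (e, u)) (φ (e, v)) ≤ d u v) {C : ℝ≥0∞}
    (hC : ∀ u, ∫⁻ e, κ (e, u) ∂m ≤ C) (u v : Z) :
    ∫⁻ e, min (κ (e, u)) (κ (e, v)) * metricCost d (φ (e, u), φ (e, v)) ∂m ≤
      C * metricCost d (u, v) :=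
  calc _ ≤ ∫⁻ e, κ (e, u) * metricCost d (u, v) ∂m :=
        lintegral_mono fun e =>
          mul_le_mul' (min_le_left _ _) (ENNReal.ofReal_le_ofReal (hφ e u v))
    _ = (∫⁻ e, κ (e, u) ∂m) * metricCost d (u, v) :=
        lintegral_mul_const' _ _ ENNReal.ofReal_ne_top
    _ ≤ _ := mul_le_mul_left (hC u) _

/-! ### Inverse problems as push updates -/

namespace IPModel

variable {X Y : Type*} [MeasurableSpace X]

/-- The kernel of the update of an inverse problem, as a push update along `Prod.snd`. -/
noncomputable def kernel (M : IPModel X Y) (y : ℕ → Y) (i : ℕ) (q : Unit × X) : ℝ≥0∞ :=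
  M.h (y i) q.2

theorem measurable_kernel (M : IPModel X Y) (y : ℕ → Y) (i : ℕ) : Measurable (M.kernel y i) :=
  ((M.measurable_h (y i)).comp measurable_snd).coe_nnreal_ennreal

theorem update_eq (M : IPModel X Y) (y : ℕ → Y) (i : ℕ) (μ : Measure X) [SFinite μ] :
    M.update y i μ = pushUpdate (Measure.dirac ()) (M.kernel y i) Prod.snd μ := by
  refine eq_pushUpdate (M.measurable_kernel y i) measurable_snd μ _ fun A hA => ?_
  rw [update, withDensity_apply _ hA, ← lintegral_indicator hA]
  refine lintegral_congr fun x => ?_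
  rw [lintegral_dirac]
  by_cases hx : x ∈ A <;> simp [kernel, hx]

theorem evidence_eq (M : IPModel X Y) (y : ℕ → Y) (i : ℕ) (μ : Measure X) :
    evidence (M.update y i) μ = ∫⁻ x, (M.h (y i) x : ℝ≥0∞) ∂μ := by
  rw [evidence, update, withDensity_apply _ .univ, Measure.restrict_univ]

theorem isPushFilter (M : IPModel X Y) (y : ℕ → Y) {P0 : Measure X} {Q : ℕ → Measure X} {k : ℕ}
    (hP0 : IsProbabilityMeasure P0) (hQ : ∀ i, IsProbabilityMeasure (Q i)) (hQ0 : Q 0 = P0)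
    (hP : ∀ i < k, M.Admissible y (i + 1) (truePosterior (M.update y) P0 i))
    (hQa : ∀ i < k, M.Admissible y (i + 1) (Q i)) :
    IsPushFilter (Measure.dirac ()) (M.kernel y) Prod.snd (M.update y) P0 Q
      (M.jointDensity P0 y) k where
  sFinite := inferInstance
  measurable_kernel := M.measurable_kernel y
  measurable_map := measurable_snd
  prob_init := hP0
  prob_approx := hQ
  approx_zero := hQ0
  true_eq i hi := haveI := (hP i hi).1; M.update_eq y _ _
  true_ne_zero i hi := M.evidence_eq y _ _ ▸ (hP i hi).2.1.ne'
  true_ne_top i hi := M.evidence_eq y _ _ ▸ (hP i hi).2.2.ne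
  approx_eq i hi := haveI := hQ i; M.update_eq y _ _
  approx_ne_zero i hi := M.evidence_eq y _ _ ▸ (hQa i hi).2.1.ne'
  approx_ne_top i hi := M.evidence_eq y _ _ ▸ (hQa i hi).2.2.ne
  density_eq n hn := by
    have hm : ∀ s t, Measurable fun x => ∏ i ∈ Finset.Icc s t, (M.h (y i) x : ℝ≥0∞) := fun s t =>
      Finset.measurable_prod _ fun i _ => (M.measurable_h (y i)).coe_nnreal_ennreal
    have := lintegral_eq_prod_evidence (Ft := M.update y) (P0 := P0) (k := k)
      (fun i hi => M.evidence_eq y _ _ ▸ (hP i hi).2.1.ne')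
      (fun i hi => M.evidence_eq y _ _ ▸ (hP i hi).2.2.ne)
      (fun s n x => ∏ i ∈ Finset.Icc (s + 1) (s + n), (M.h (y i) x : ℝ≥0∞)) (by simp)
      (fun i _ n => ?_) hn
    · simpa [jointDensity] using this
    · rw [update, lintegral_withDensity_eq_lintegral_mul _
        (M.measurable_h (y (i + 1))).coe_nnreal_ennreal (hm _ _)]
      refine lintegral_congr fun x => ?_
      rw [Pi.mul_apply, show i + 1 + n = i + (n + 1) by ring,
        ← Finset.insert_Icc_add_one_left_eq_Icc (show i + 1 ≤ i + (n + 1) by omega),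
        Finset.prod_insert (by simp)]

theorem lintegral_kernel_le (M : IPModel X Y) (y : ℕ → Y) (i : ℕ) (u : X) :
    ∫⁻ e, M.kernel y i (e, u) ∂(Measure.dirac ()) ≤ M.C y i := by
  rw [lintegral_dirac]
  exact le_iSup (fun x => (M.h (y i) x : ℝ≥0∞)) u

end IPModel

/-! ### State estimation as push updates -/

namespace SEModel

variable {X Y : Type*} [MeasurableSpace X]

/-- The kernel of the update in state estimation, as a push update along `Prod.fst`. -/
noncomputable def kernel (M : SEModel X Y) (y : ℕ → Y) (i : ℕ) (q : X × X) : ℝ≥0∞ :=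
  M.h i (y i) q.1 * M.T i q.1 q.2

theorem measurable_kernel (M : SEModel X Y) (y : ℕ → Y) (i : ℕ) : Measurable (M.kernel y i) :=
  ((M.measurable_h i (y i)).comp measurable_fst).coe_nnreal_ennreal.mul
    (M.measurable_T i).coe_nnreal_ennreal

theorem update_eq (M : SEModel X Y) (ν : Measure X) [SFinite ν] (y : ℕ → Y) (i : ℕ)
    (μ : Measure X) [SFinite μ] :
    M.update ν y i μ = pushUpdate ν (M.kernel y i) Prod.fst μ := by
  have hk := M.measurable_kernel y i
  refine eq_pushUpdate hk measurable_fst μ _ fun A hA => ?_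
  have hm : Measurable fun q : X × X => M.kernel y i q * A.indicator 1 q.1 :=
    hk.mul ((measurable_one.indicator hA).comp measurable_fst)
  rw [update, withDensity_apply _ hA, ← lintegral_indicator hA,
    lintegral_lintegral_swap (f := fun u e => M.kernel y i (e, u) * A.indicator 1 e)
      (hm.comp measurable_swap).aemeasurable]
  refine lintegral_congr fun x => ?_
  by_cases hx : x ∈ A
  · simp only [Set.indicator_of_mem hx, Pi.one_apply, mul_one, kernel]
    rw [lintegral_const_mul' _ _ ENNReal.coe_ne_top]
  · simp [hx]

theorem evidence_eq (M : SEModel X Y) (ν : Measure X) (y : ℕ → Y) (i : ℕ) (μ : Measure X) :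
    evidence (M.update ν y i) μ =
      ∫⁻ x, (M.h i (y i) x : ℝ≥0∞) * ∫⁻ x', (M.T i x x' : ℝ≥0∞) ∂μ ∂ν := by
  rw [evidence, update, withDensity_apply _ .univ, Measure.restrict_univ]

theorem isPushFilter (M : SEModel X Y) (ν : Measure X) [SigmaFinite ν] (y : ℕ → Y) {P0 : Measure X}
    {Q : ℕ → Measure X} {k : ℕ}
    (hP0 : IsProbabilityMeasure P0) (hQ : ∀ i, IsProbabilityMeasure (Q i)) (hQ0 : Q 0 = P0)
    (hP : ∀ i < k, M.Admissible ν y (i + 1) (truePosterior (M.update ν y) P0 i))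
    (hQa : ∀ i < k, M.Admissible ν y (i + 1) (Q i)) :
    IsPushFilter ν (M.kernel y) Prod.fst (M.update ν y) P0 Q (M.jointDensity ν P0 y) k where
  sFinite := inferInstance
  measurable_kernel := M.measurable_kernel y
  measurable_map := measurable_fst
  prob_init := hP0
  prob_approx := hQ
  approx_zero := hQ0
  true_eq i hi := haveI := (hP i hi).1; M.update_eq ν y _ _
  true_ne_zero i hi := M.evidence_eq ν y _ _ ▸ (hP i hi).2.2.1.ne'
  true_ne_top i hi := M.evidence_eq ν y _ _ ▸ (hP i hi).2.2.2.ne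
  approx_eq i hi := haveI := hQ i; M.update_eq ν y _ _
  approx_ne_zero i hi := M.evidence_eq ν y _ _ ▸ (hQa i hi).2.2.1.ne'
  approx_ne_top i hi := M.evidence_eq ν y _ _ ▸ (hQa i hi).2.2.2.ne
  density_eq n hn := by
    have hk := M.measurable_kernel y
    have hmeas : ∀ s n, Measurable (pathWeight ν (fun i x x' => M.kernel y i (x, x')) s n) :=
      fun s n => (measurable_pathWeight (W := Unit) ν (g := fun i x x' _ => M.kernel y i (x, x'))
        (fun i => (hk i).comp (measurable_fst.prodMk (measurable_fst.comp measurable_snd))) n s).comp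
        (measurable_id.prodMk (measurable_const (a := ())))
    rw [← lintegral_eq_prod_evidence (Ft := M.update ν y) (P0 := P0) (k := k)
      (fun i hi => M.evidence_eq ν y _ _ ▸ (hP i hi).2.2.1.ne')
      (fun i hi => M.evidence_eq ν y _ _ ▸ (hP i hi).2.2.2.ne)
      (pathWeight ν fun i x x' => M.kernel y i (x, x')) (fun s x => rfl) (fun i hi n => ?_) hn]
    · refine lintegral_congr fun x0 => ?_
      rw [← lintegral_pi_prod_eq_pathWeight ν (g := fun i x x' => M.kernel y i (x, x')) hk n 0 x0]
      simp only [kernel, zero_add]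
    · have := (hP i hi).1
      rw [M.update_eq ν y, lintegral_pushUpdate (hk _) measurable_fst _ (hmeas _ _)]
      rfl

theorem lintegral_kernel_le (M : SEModel X Y) (ν : Measure X) (y : ℕ → Y) (i : ℕ) (u : X) :
    ∫⁻ e, M.kernel y i (e, u) ∂ν ≤ M.C ν y i :=
  le_iSup (fun x' => ∫⁻ x, (M.h i (y i) x : ℝ≥0∞) * (M.T i x x' : ℝ≥0∞) ∂ν) u

end SEModel

/-! ### Parameter-state estimation as push updates -/

namespace PSModel

variable {X W Y : Type*} [MeasurableSpace X] [MeasurableSpace W]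

/-- The kernel of the update in parameter-state estimation, as a push update along
`(x, (x', w)) ↦ (x, w)`. -/
noncomputable def kernel (M : PSModel X W Y) (y : ℕ → Y) (i : ℕ) (q : X × (X × W)) : ℝ≥0∞ :=
  M.h i (y i) q.1 q.2.2 * M.T i q.1 q.2.1 q.2.2

theorem measurable_kernel (M : PSModel X W Y) (y : ℕ → Y) (i : ℕ) : Measurable (M.kernel y i) :=
  ((M.measurable_h i (y i)).comp (measurable_fst.prodMk
    (measurable_snd.comp measurable_snd))).coe_nnreal_ennreal.mul
    (M.measurable_T i).coe_nnreal_ennreal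

theorem measurable_updateDensity (M : PSModel X W Y) (ν : Measure X) [SFinite ν] (y : ℕ → Y)
    (i : ℕ) {π : X × W → ℝ≥0∞} (hπ : Measurable π) : Measurable (M.updateDensity ν y i π) := by
  refine (M.measurable_h i (y i)).coe_nnreal_ennreal.mul ?_
  refine Measurable.lintegral_prod_left'
    (f := fun q : X × (X × W) => (M.T i q.2.1 q.1 q.2.2 : ℝ≥0∞) * π (q.1, q.2.2)) ?_
  refine Measurable.mul (Measurable.coe_nnreal_ennreal ?_) (hπ.comp (by fun_prop))
  exact (M.measurable_T i).comp (f := fun q : X × (X × W) => (q.2.1, q.1, q.2.2)) (by fun_prop)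

/-- Fubini with `w` outermost and the two states swapped inside. The right side involves `π` only
through its measure, so the update does not depend on the version of the density. -/
theorem withDensity_updateDensity_eq (M : PSModel X W Y) (ν : Measure X) [SFinite ν]
    (ρ : Measure W) [SFinite ρ] (y : ℕ → Y) (i : ℕ) {π : X × W → ℝ≥0∞} (hπ : Measurable π) :
    (ν.prod ρ).withDensity (M.updateDensity ν y i π) =
      pushUpdate ν (M.kernel y i) (fun q => (q.1, q.2.2)) ((ν.prod ρ).withDensity π) := by
  have hk := M.measurable_kernel y i
  have hφ : Measurable fun q : X × (X × W) => (q.1, q.2.2) := by fun_prop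
  refine eq_pushUpdate hk hφ _ _ fun A hA => ?_
  have hA1 : Measurable (A.indicator (1 : X × W → ℝ≥0∞)) := measurable_one.indicator hA
  have hm : Measurable fun q : X × (X × W) => M.kernel y i q * A.indicator 1 (q.1, q.2.2) :=
    hk.mul (hA1.comp hφ)
  have hmi := hm.lintegral_prod_left' (μ := ν)
  rw [withDensity_apply _ hA, ← lintegral_indicator hA,
    lintegral_prod_symm' _ ((M.measurable_updateDensity ν y i hπ).indicator hA),
    lintegral_withDensity_eq_lintegral_mul _ hπ hmi, lintegral_prod_symm' _ (hπ.mul hmi)]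
  refine lintegral_congr fun w => ?_
  have hw : Measurable fun q : X × X => π (q.1, w) *
      (M.kernel y i (q.2, (q.1, w)) * A.indicator 1 (q.2, w)) :=
    (hπ.comp (f := fun q : X × X => (q.1, w)) (by fun_prop)).mul
      (hm.comp (g := fun q : X × (X × W) => M.kernel y i q * A.indicator 1 (q.1, q.2.2))
        (f := fun q : X × X => (q.2, (q.1, w))) (by fun_prop))
  have hw' : ∀ x', Measurable fun x => M.kernel y i (x, (x', w)) * A.indicator 1 (x, w) :=
    fun x' => hm.comp (g := fun q : X × (X × W) => M.kernel y i q * A.indicator 1 (q.1, q.2.2))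
      (f := fun x => (x, (x', w))) (by fun_prop)
  simp only [Pi.mul_apply]
  simp only [← lintegral_const_mul _ (hw' _)]
  rw [lintegral_lintegral_swap hw.aemeasurable]
  refine lintegral_congr fun x => ?_
  by_cases hx : (x, w) ∈ A
  · simp only [Set.indicator_of_mem hx, Pi.one_apply, mul_one, kernel, updateDensity]
    rw [← lintegral_const_mul' _ _ ENNReal.coe_ne_top]
    exact lintegral_congr fun x' => by ring
  · simp [hx]

theorem update_eq (M : PSModel X W Y) (ν : Measure X) [SigmaFinite ν] (ρ : Measure W)
    [SigmaFinite ρ] (y : ℕ → Y) (i : ℕ) (μ : Measure (X × W)) [SigmaFinite μ]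
    (h : μ ≪ ν.prod ρ) :
    M.update ν ρ y i μ = pushUpdate ν (M.kernel y i) (fun q => (q.1, q.2.2)) μ := by
  rw [update, M.withDensity_updateDensity_eq ν ρ y i (Measure.measurable_rnDeriv _ _),
    Measure.withDensity_rnDeriv_eq _ _ h]

theorem Admissible.absolutelyContinuous {M : PSModel X W Y} {ν : Measure X} {ρ : Measure W}
    {y : ℕ → Y} {i : ℕ} {μ : Measure (X × W)} (h : M.Admissible ν ρ y i μ) : μ ≪ ν.prod ρ := by
  obtain ⟨-, π, -, rfl, -⟩ := h
  exact withDensity_absolutelyContinuous _ _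

/-- Admissibility speaks of some version `π`, the update of the Radon-Nikodym derivative; both give
the same push update, hence the same evidence. -/
theorem Admissible.evidence_ne {M : PSModel X W Y} {ν : Measure X} [SigmaFinite ν]
    {ρ : Measure W} [SigmaFinite ρ] {y : ℕ → Y} {i : ℕ} {μ : Measure (X × W)}
    (h : M.Admissible ν ρ y i μ) :
    evidence (M.update ν ρ y i) μ ≠ 0 ∧ evidence (M.update ν ρ y i) μ ≠ ∞ := by
  have hac := h.absolutelyContinuous
  obtain ⟨_, π, hπ, hμ, -, h0, h1⟩ := h
  have : evidence (M.update ν ρ y i) μ = ∫⁻ p, M.updateDensity ν y i π p ∂(ν.prod ρ) := by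
    rw [evidence, M.update_eq ν ρ y i μ hac, hμ, ← M.withDensity_updateDensity_eq ν ρ y i hπ,
      withDensity_apply _ .univ, Measure.restrict_univ]
  rw [this]
  exact ⟨h0.ne', h1.ne⟩

theorem isPushFilter (M : PSModel X W Y) (ν : Measure X) [SigmaFinite ν] (ρ : Measure W)
    [SigmaFinite ρ] (y : ℕ → Y) {P0 : Measure (X × W)} {Q : ℕ → Measure (X × W)} {k : ℕ}
    (hP0 : IsProbabilityMeasure P0) (hQ : ∀ i, IsProbabilityMeasure (Q i)) (hQ0 : Q 0 = P0)
    (hP : ∀ i < k, M.Admissible ν ρ y (i + 1) (truePosterior (M.update ν ρ y) P0 i))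
    (hQa : ∀ i < k, M.Admissible ν ρ y (i + 1) (Q i)) :
    IsPushFilter ν (M.kernel y) (fun q => (q.1, q.2.2)) (M.update ν ρ y) P0 Q
      (M.jointDensity ν P0 y) k where
  sFinite := inferInstance
  measurable_kernel := M.measurable_kernel y
  measurable_map := by fun_prop
  prob_init := hP0
  prob_approx := hQ
  approx_zero := hQ0
  true_eq i hi := haveI := (hP i hi).1; M.update_eq ν ρ y _ _ (hP i hi).absolutelyContinuous
  true_ne_zero i hi := (hP i hi).evidence_ne.1
  true_ne_top i hi := (hP i hi).evidence_ne.2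
  approx_eq i hi := haveI := hQ i; M.update_eq ν ρ y _ _ (hQa i hi).absolutelyContinuous
  approx_ne_zero i hi := (hQa i hi).evidence_ne.1
  approx_ne_top i hi := (hQa i hi).evidence_ne.2
  density_eq n hn := by
    have hk := M.measurable_kernel y
    have hmeas : ∀ s n, Measurable fun q : X × W =>
        pathWeight ν (fun i x x' => M.kernel y i (x, (x', q.2))) s n q.1 :=
      fun s n => measurable_pathWeight ν (g := fun i x x' w => M.kernel y i (x, (x', w))) hk n s
    rw [← lintegral_eq_prod_evidence (Ft := M.update ν ρ y) (P0 := P0) (k := k)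
      (fun i hi => (hP i hi).evidence_ne.1) (fun i hi => (hP i hi).evidence_ne.2)
      (fun s n q => pathWeight ν (fun i x x' => M.kernel y i (x, (x', q.2))) s n q.1)
      (fun s x => rfl) (fun i hi n => ?_) hn]
    · refine lintegral_congr fun q => ?_
      rw [← lintegral_pi_prod_eq_pathWeight ν (g := fun i x x' => M.kernel y i (x, (x', q.2)))
        (fun i => (hk i).comp (f := fun p : X × X => (p.1, (p.2, q.2))) (by fun_prop)) n 0 q.1]
      simp only [kernel, zero_add]
    · have := (hP i hi).1
      rw [M.update_eq ν ρ y _ _ (hP i hi).absolutelyContinuous,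
        lintegral_pushUpdate (hk _) (by fun_prop) _ (hmeas _ _)]
      rfl

theorem lintegral_kernel_le (M : PSModel X W Y) (ν : Measure X) (y : ℕ → Y) (i : ℕ) (u : X × W) :
    ∫⁻ e, M.kernel y i (e, u) ∂ν ≤ M.C ν y i :=
  le_iSup₂ (f := fun (x' : X) (w : W) =>
    ∫⁻ x, (M.h i (y i) x w : ℝ≥0∞) * (M.T i x x' w : ℝ≥0∞) ∂ν) u.1 u.2

end PSModel

theorem forall_approx_of_forall {Z : Type*} [MeasurableSpace Z] {adm : ℕ → Measure Z → Prop}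
    {Ft : ℕ → Measure Z → Measure Z} {P0 : Measure Z} {Q : ℕ → Measure Z} (hQ0 : Q 0 = P0)
    {k : ℕ} (hk : 1 ≤ k)
    (hP : ∀ i ∈ Finset.Icc 0 (k - 1), adm (i + 1) (truePosterior Ft P0 i))
    (hQ : ∀ i ∈ Finset.Icc 1 (k - 1), adm (i + 1) (Q i)) :
    (∀ i < k, adm (i + 1) (truePosterior Ft P0 i)) ∧ ∀ i < k, adm (i + 1) (Q i) := by
  have hP' : ∀ i < k, adm (i + 1) (truePosterior Ft P0 i) := fun i hi =>
    hP i (by simp only [Finset.mem_Icc]; omega)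
  refine ⟨hP', fun i hi => ?_⟩
  rcases Nat.eq_zero_or_pos i with rfl | h
  · rw [hQ0]; exact hP' 0 hi
  · exact hQ i (by simp only [Finset.mem_Icc]; omega)

end BayesSeq

/-! ### The three problems assembled -/

theorem mainTheorem2 {X W Y : Type*} [MeasurableSpace X] [MeasurableSpace W]
    (y : ℕ → Y) (k : ℕ) (hk : 2 ≤ k) :
    -- Inverse problems
    (∀ (d : X → X → ℝ) (M : IPModel X Y) (P0 : Measure X) (Q : ℕ → Measure X),
      IsPolishMetric d → IsProbabilityMeasure P0 → (∀ i, IsProbabilityMeasure (Q i)) → Q 0 = P0 →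
      (∀ i ∈ Finset.Icc 0 (k - 1), M.Admissible y (i + 1) (truePosterior (M.update y) P0 i)) →
      (∀ i ∈ Finset.Icc 1 (k - 1), M.Admissible y (i + 1) (Q i)) →
      ((∀ i ∈ Finset.Icc 1 k, M.C y i < ∞) →
        (tvDist (truePosterior (M.update y) P0 k) (Q k) ≤
            errorBound tvDist (fun j => (∏ i ∈ Finset.Icc (j + 1) k, (M.C y i).toReal) /
              predictive (M.jointDensity P0 y) j k) (M.update y) Q k ∧
          tvDist (truePosterior (M.update y) P0 k) (Q k) ≤
            errorBound tvDist (fun j => ∏ i ∈ Finset.Icc (j + 1) k,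
              (M.C y i).toReal / (evidence (M.update y i) (Q (i - 1))).toReal)
              (M.update y) Q k) ∧
        (hellingerDist (truePosterior (M.update y) P0 k) (Q k) ≤
            errorBound hellingerDist (fun j =>
              2 ^ (k - j) * (∏ i ∈ Finset.Icc (j + 1) k, √(M.C y i).toReal) /
              √(predictive (M.jointDensity P0 y) j k)) (M.update y) Q k ∧
          hellingerDist (truePosterior (M.update y) P0 k) (Q k) ≤
            errorBound hellingerDist (fun j => 2 ^ (k - j) * ∏ i ∈ Finset.Icc (j + 1) k,
              √(M.C y i).toReal / √(evidence (M.update y i) (Q (i - 1))).toReal)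
              (M.update y) Q k)) ∧
      (∀ D : ℝ, (∀ i ∈ Finset.Icc 1 k, M.C y i < ∞) → (∀ i ∈ Finset.Icc 1 k, M.hLip d y i < ∞) →
        IsLUB (Set.range fun p : X × X => d p.1 p.2) D →
        wasserstein1 d (truePosterior (M.update y) P0 k) (Q k) ≤
            errorBound (wasserstein1 d) (fun j =>
              (∏ i ∈ Finset.Icc (j + 1) k, (2 * D * (M.hLip d y i).toReal + (M.C y i).toReal)) /
              predictive (M.jointDensity P0 y) j k) (M.update y) Q k ∧
          wasserstein1 d (truePosterior (M.update y) P0 k) (Q k) ≤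
            errorBound (wasserstein1 d) (fun j => ∏ i ∈ Finset.Icc (j + 1) k,
              (2 * D * (M.hLip d y i).toReal + (M.C y i).toReal) /
                (evidence (M.update y i) (Q (i - 1))).toReal) (M.update y) Q k)) ∧
    -- State estimation
    (∀ (d : X → X → ℝ) (ν : Measure X) (M : SEModel X Y) (P0 : Measure X) (Q : ℕ → Measure X),
      IsPolishMetric d → SigmaFinite ν →
      IsProbabilityMeasure P0 → (∀ i, IsProbabilityMeasure (Q i)) → Q 0 = P0 →
      (∀ i ∈ Finset.Icc 0 (k - 1), M.Admissible ν y (i + 1) (truePosterior (M.update ν y) P0 i)) →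
      (∀ i ∈ Finset.Icc 1 (k - 1), M.Admissible ν y (i + 1) (Q i)) →
      ((∀ i ∈ Finset.Icc 1 k, M.C ν y i < ∞) →
        (tvDist (truePosterior (M.update ν y) P0 k) (Q k) ≤
            errorBound tvDist (fun j => (∏ i ∈ Finset.Icc (j + 1) k, (M.C ν y i).toReal) /
              predictive (M.jointDensity ν P0 y) j k) (M.update ν y) Q k ∧
          tvDist (truePosterior (M.update ν y) P0 k) (Q k) ≤
            errorBound tvDist (fun j => ∏ i ∈ Finset.Icc (j + 1) k,
              (M.C ν y i).toReal / (evidence (M.update ν y i) (Q (i - 1))).toReal)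
              (M.update ν y) Q k) ∧
        (hellingerDist (truePosterior (M.update ν y) P0 k) (Q k) ≤
            errorBound hellingerDist (fun j =>
              2 ^ (k - j) * (∏ i ∈ Finset.Icc (j + 1) k, √(M.C ν y i).toReal) /
              √(predictive (M.jointDensity ν P0 y) j k)) (M.update ν y) Q k ∧
          hellingerDist (truePosterior (M.update ν y) P0 k) (Q k) ≤
            errorBound hellingerDist (fun j => 2 ^ (k - j) * ∏ i ∈ Finset.Icc (j + 1) k,
              √(M.C ν y i).toReal / √(evidence (M.update ν y i) (Q (i - 1))).toReal)
              (M.update ν y) Q k)) ∧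
      (∀ D : ℝ, (∀ i ∈ Finset.Icc 1 k, ∀ x, M.TLip d i x < ∞) →
        (∀ i ∈ Finset.Icc 1 k, M.Cstar ν d y i < ∞) →
        IsLUB (Set.range fun p : X × X => d p.1 p.2) D →
        wasserstein1 d (truePosterior (M.update ν y) P0 k) (Q k) ≤
            errorBound (wasserstein1 d) (fun j =>
              (2 * D) ^ (k - j) * (∏ i ∈ Finset.Icc (j + 1) k, (M.Cstar ν d y i).toReal) /
              predictive (M.jointDensity ν P0 y) j k) (M.update ν y) Q k ∧
          wasserstein1 d (truePosterior (M.update ν y) P0 k) (Q k) ≤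
            errorBound (wasserstein1 d) (fun j =>
              (2 * D) ^ (k - j) * ∏ i ∈ Finset.Icc (j + 1) k,
                (M.Cstar ν d y i).toReal / (evidence (M.update ν y i) (Q (i - 1))).toReal)
              (M.update ν y) Q k)) ∧
    -- Parameter-state estimation
    (∀ (d : X × W → X × W → ℝ) (ν : Measure X) (ρ : Measure W) (M : PSModel X W Y)
      (P0 : Measure (X × W)) (Q : ℕ → Measure (X × W)),
      IsPolishMetric d → SigmaFinite ν → SigmaFinite ρ →
      IsProbabilityMeasure P0 → (∀ i, IsProbabilityMeasure (Q i)) → Q 0 = P0 →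
      (∀ i ∈ Finset.Icc 0 (k - 1),
        M.Admissible ν ρ y (i + 1) (truePosterior (M.update ν ρ y) P0 i)) →
      (∀ i ∈ Finset.Icc 1 (k - 1), M.Admissible ν ρ y (i + 1) (Q i)) →
      ((∀ i ∈ Finset.Icc 1 k, M.C ν y i < ∞) →
        (tvDist (truePosterior (M.update ν ρ y) P0 k) (Q k) ≤
            errorBound tvDist (fun j => (∏ i ∈ Finset.Icc (j + 1) k, (M.C ν y i).toReal) /
              predictive (M.jointDensity ν P0 y) j k) (M.update ν ρ y) Q k ∧
          tvDist (truePosterior (M.update ν ρ y) P0 k) (Q k) ≤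
            errorBound tvDist (fun j => ∏ i ∈ Finset.Icc (j + 1) k,
              (M.C ν y i).toReal / (evidence (M.update ν ρ y i) (Q (i - 1))).toReal)
              (M.update ν ρ y) Q k) ∧
        (hellingerDist (truePosterior (M.update ν ρ y) P0 k) (Q k) ≤
            errorBound hellingerDist (fun j =>
              2 ^ (k - j) * (∏ i ∈ Finset.Icc (j + 1) k, √(M.C ν y i).toReal) /
              √(predictive (M.jointDensity ν P0 y) j k)) (M.update ν ρ y) Q k ∧
          hellingerDist (truePosterior (M.update ν ρ y) P0 k) (Q k) ≤
            errorBound hellingerDist (fun j => 2 ^ (k - j) * ∏ i ∈ Finset.Icc (j + 1) k,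
              √(M.C ν y i).toReal / √(evidence (M.update ν ρ y i) (Q (i - 1))).toReal)
              (M.update ν ρ y) Q k)) ∧
      (∀ D : ℝ, (∀ i ∈ Finset.Icc 1 k, M.C ν y i < ∞) →
        (∀ i ∈ Finset.Icc 1 k, ∀ x, M.fLip d y i x < ∞) →
        (∀ i ∈ Finset.Icc 1 k, M.Cstar ν d y i < ∞) →
        (∀ (x x₁ x₂ : X) (w w' : W), d (x, w) (x, w') ≤ d (x₁, w) (x₂, w')) →
        IsLUB (Set.range fun p : (X × W) × (X × W) => d p.1 p.2) D →
        wasserstein1 d (truePosterior (M.update ν ρ y) P0 k) (Q k) ≤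
            errorBound (wasserstein1 d) (fun j =>
              (∏ i ∈ Finset.Icc (j + 1) k,
                (2 * D * (M.Cstar ν d y i).toReal + (M.C ν y i).toReal)) /
              predictive (M.jointDensity ν P0 y) j k) (M.update ν ρ y) Q k ∧
          wasserstein1 d (truePosterior (M.update ν ρ y) P0 k) (Q k) ≤
            errorBound (wasserstein1 d) (fun j => ∏ i ∈ Finset.Icc (j + 1) k,
              (2 * D * (M.Cstar ν d y i).toReal + (M.C ν y i).toReal) /
                (evidence (M.update ν ρ y i) (Q (i - 1))).toReal) (M.update ν ρ y) Q k)) := by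
  have hk1 : 1 ≤ k := by omega
  refine ⟨?_, ?_, ?_⟩
  · intro d M P0 Q hd hP0 hQ hQ0 hP hQa
    obtain ⟨hP', hQ'⟩ := forall_approx_of_forall hQ0 hk1 hP hQa
    have H := M.isPushFilter y hP0 hQ hQ0 hP' hQ'
    refine ⟨fun hC => ⟨H.tvDist_le hk1 hC (M.lintegral_kernel_le y),
      H.hellingerDist_le hk1 hC (M.lintegral_kernel_le y)⟩, fun D hC hL hD => ?_⟩
    -- Points do not move under an IP update, so common mass costs its initial displacement.
    have := H.wasserstein1_le hk1 hd hD (A := M.C y) (L := fun i _ => M.hLip d y i) hC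
      (fun i hi => by simpa using hL i hi)
      (fun i => lintegral_min_mul_cost_le (φ := Prod.snd) (fun _ _ _ => le_rfl)
        (M.lintegral_kernel_le y i))
      (fun i e u v => ofReal_le_add_lipConst_mul hd (M.h (y i)) u v)
    simpa only [lintegral_dirac] using this
  · intro d ν M P0 Q hd hν hP0 hQ hQ0 hP hQa
    obtain ⟨hP', hQ'⟩ := forall_approx_of_forall hQ0 hk1 hP hQa
    have H := M.isPushFilter ν y hP0 hQ hQ0 hP' hQ'
    refine ⟨fun hC => ⟨H.tvDist_le hk1 hC (M.lintegral_kernel_le ν y),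
      H.hellingerDist_le hk1 hC (M.lintegral_kernel_le ν y)⟩, fun D _ hCs hD => ?_⟩
    -- The new state is `e` for both points, so common mass moves at no cost; only the Lipschitz
    -- term survives.
    have := H.wasserstein1_le hk1 hd hD (A := fun _ => 0)
      (L := fun i x => M.h i (y i) x * M.TLip d i x) (fun _ _ => ENNReal.zero_lt_top) hCs
      (fun i u v => by simp [metricCost, hd.self])
      (fun i e u v => by
        rw [SEModel.kernel, SEModel.kernel, mul_assoc, ← mul_add]
        exact mul_le_mul_right (ofReal_le_add_lipConst_mul hd (M.T i e) u v) _)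
    simp only [ENNReal.toReal_zero, add_zero, mul_div_assoc (2 * D), prod_const_mul_Icc] at this
    exact this
  · intro d ν ρ M P0 Q hd hν hρ hP0 hQ hQ0 hP hQa
    obtain ⟨hP', hQ'⟩ := forall_approx_of_forall hQ0 hk1 hP hQa
    have H := M.isPushFilter ν ρ y hP0 hQ hQ0 hP' hQ'
    refine ⟨fun hC => ⟨H.tvDist_le hk1 hC (M.lintegral_kernel_le ν y),
      H.hellingerDist_le hk1 hC (M.lintegral_kernel_le ν y)⟩, fun D hC _ hCs hmono hD => ?_⟩
    -- Both points get the same new state and keep their parameters; `hmono` says that this does not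
    -- increase their distance.
    exact H.wasserstein1_le hk1 hd hD (A := M.C ν y) (L := M.fLip d y) hC hCs
      (fun i => lintegral_min_mul_cost_le (φ := fun q => (q.1, q.2.2))
        (fun e u v => hmono e u.1 v.1 u.2 v.2)
        (M.lintegral_kernel_le ν y i))
      (fun i e u v => by
        simpa only [NNReal.coe_mul, ENNReal.coe_mul, PSModel.kernel, PSModel.fLip] using ofReal_le_add_lipConst_mul hd
          (fun q : X × W => M.h i (y i) e q.2 * M.T i e q.1 q.2) u v)
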